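/- Let $G=(V,w)$ be a weighted graph: a (finite or infinite) vertex set $V$ with a symmetric function $w:V\times V\to[0,\infty)$, whose edges are the support of $w$ (loops allowed), such that $w_x:=\sum_{y}w(x,y)<\infty$ for every vertex $x$. The random walk on $G$ moves from $x$ to $y$ with probability $w(x,y)/w_x$. Let $o$ be a vertex with $w_o>0$, let $z$ be a vertex set with $w_z:=\sum_{x\in z}w_x<\infty$, and let $T_{oz}\in\{0,1,2,\dots,\infty\}$ be the first time the walk started at $o$ visits $z$. Let $r_{oz}$ be the effective resistance between $o$ and $z$ when the edge weights are conductances, that is, $1/r_{oz}=\inf\{\frac12\sum_{x,y}w(x,y)(f(x)-f(y))^2 : f:V\to\mathbb R,\ f(o)=1,\ f=0 \text{ on } z\}$. For $g>1$ let $T'_{01}$ be the time at which biased simple random walk on $\mathbb Z$ with odds $1$ and $g$ of going left and right, started at $0$, first hits $1$. Let $m_g=\mathbf E T'_{01}$ be its mean and $I_g(a)=\sup_{\lambda\in\mathbb R}\big(\lambda a-\log\mathbf E e^{\lambda T'_{01}}\big)\in[0,\infty]$ its large deviation rate function. Suppose that $\mathrm{dist}(o,z)\ge n+1$ in the graph distance,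 for some integer $n\ge 0$. Then $$\mathbf E T_{oz}\ \ge\ m_g n+1,\qquad \mathbf P(T_{oz}\le an+1)\ \le\ e^{-I_g(a)n}\quad\text{for all real } a\le m_g.$$ Here $g$ may be taken to be either (a) the solution $g>1$ of $(g-1)^2g^{n-2}=2w_z/w_o$ (if there is one; it exists and is unique if $n\ge1$ and $w_z>0$), or (b) $g=(w_z r_{oz})^{1/n}$, if $n\ge 1$ and $r_{oz}<\infty$; in this case $g>1$. Moreover, for every $g>1$, $$m_g=\frac{g+1}{g-1},\qquad e^{-I_g(a)}=\frac{g}{a+1}\left(\frac{g}{a^2-1}\right)^{\frac{a-1}{2}}\left(\frac{2a}{g+1}\right)^a\quad (a>1).$$ -/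

import Mathlib

open MeasureTheory ProbabilityTheory
open scoped ENNReal NNReal

noncomputable section

/-- A weighted graph on the vertex set `V`: a symmetric nonnegative function on `V × V` whose
total weight at each vertex is finite, so that the random walk makes sense. Loops are allowed,
and `V` may be infinite. -/
structure WeightedGraph (V : Type*) where
  w : V → V → ℝ≥0
  symm : ∀ x y, w x y = w y x
  finite_weight : ∀ x, (∑' y, (w x y : ℝ≥0∞)) ≠ ∞

namespace WeightedGraph

variable {V : Type*} (G : WeightedGraph V)

/-- The weight `w_x` of a vertex. -/
def vertexWeight (x : V) : ℝ≥0∞ := ∑' y, (G.w x y : ℝ≥0∞)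

/-- The weight `w_z` of a vertex set. -/
def setWeight (z : Set V) : ℝ≥0∞ := ∑' x : z, G.vertexWeight x

/-- The graph whose edges are the support of `w` (loops play no role for the distance). -/
def graph : SimpleGraph V where
  Adj x y := x ≠ y ∧ G.w x y ≠ 0
  symm := ⟨fun x y h => ⟨h.1.symm, by rw [G.symm y x]; exact h.2⟩⟩
  loopless := ⟨fun _ h => h.1 rfl⟩

/-- The graph distance from a vertex to a vertex set, `⊤` if the set cannot be reached. -/
def distTo (o : V) (z : Set V) : ℕ∞ := ⨅ y ∈ z, G.graph.edist o y

open Classical in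
/-- One step of the random walk: from `x` to `y` with probability `w x y / w_x`. An isolated
vertex (of weight zero) is never left; such a vertex is not reached from any other one. -/
def step (x : V) : PMF V :=
  if h : (∑' y, (G.w x y : ℝ≥0∞)) = 0 then PMF.pure x
  else PMF.normalize (fun y => (G.w x y : ℝ≥0∞)) h (G.finite_weight x)

/-- The Dirichlet energy of a function; each edge is counted once. -/
def energy (f : V → ℝ) : ℝ≥0∞ :=
  (∑' x, ∑' y, (G.w x y : ℝ≥0∞) * ENNReal.ofReal ((f x - f y) ^ 2)) / 2

/-- The effective conductance between `o` and `z` when edge weights are conductances, by the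
Dirichlet principle. -/
def effConductance (o : V) (z : Set V) : ℝ≥0∞ :=
  ⨅ f ∈ {f : V → ℝ | f o = 1 ∧ ∀ x ∈ z, f x = 0}, G.energy f

/-- The effective resistance between `o` and `z`. -/
def effResistance (o : V) (z : Set V) : ℝ≥0∞ := (G.effConductance o z)⁻¹

end WeightedGraph

/-- The space of trajectories, with the product of the discrete sigma-algebras. -/
abbrev trajSpace (V : Type*) : MeasurableSpace (ℕ → V) :=
  @MeasurableSpace.pi ℕ (fun _ => V) (fun _ => ⊤)

/-- The law, on the space of trajectories, of the Markov chain that starts at `o` and makes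
steps with distribution `K`. -/
def chainLaw {V : Type*} (K : V → PMF V) (o : V) : @Measure (ℕ → V) (trajSpace V) :=
  letI : MeasurableSpace V := ⊤
  let k : Kernel V V := ⟨fun x => (K x).toMeasure, measurable_from_top⟩
  haveI : IsMarkovKernel k := ⟨fun x => PMF.toMeasure.isProbabilityMeasure (K x)⟩
  Kernel.trajMeasure (X := fun _ => V) (Measure.dirac o)
    (fun n => k.comap (fun x => x ⟨n, Finset.mem_Iic.2 le_rfl⟩) (measurable_pi_apply _))

/-- The first time the trajectory `x` visits `z`, `⊤` if it never does. -/
def hitTime {V : Type*} (z : Set V) (x : ℕ → V) : ℕ∞ := ⨅ (k : ℕ) (_ : x k ∈ z), (k : ℕ∞)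

/-- The expected value of the hitting time of `z` for the chain started at `o`. -/
def meanHit {V : Type*} (K : V → PMF V) (o : V) (z : Set V) : ℝ≥0∞ :=
  letI := trajSpace V
  ∫⁻ x, (hitTime z x : ℝ≥0∞) ∂(chainLaw K o)

/-- The probability that the hitting time of `z` for the chain started at `o` is at most `t`. -/
def probHitLE {V : Type*} (K : V → PMF V) (o : V) (z : Set V) (t : ℝ) : ℝ≥0∞ :=
  letI := trajSpace V
  chainLaw K o {x | ((hitTime z x : ℝ≥0∞) : EReal) ≤ (t : EReal)}

/-- The moment generating function of the hitting time of `z` for the chain started at `o`. -/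
def mgfHit {V : Type*} (K : V → PMF V) (o : V) (z : Set V) (s : ℝ) : ℝ≥0∞ :=
  letI := trajSpace V
  ∫⁻ x, EReal.exp ((s : EReal) * ((hitTime z x : ℝ≥0∞) : EReal)) ∂(chainLaw K o)

/-- The large deviation (Cramér) rate function of the hitting time: the Legendre transform of
the logarithmic moment generating function. -/
def rateHit {V : Type*} (K : V → PMF V) (o : V) (z : Set V) (a : ℝ) : EReal :=
  ⨆ s : ℝ, (((s * a : ℝ) : EReal) - ENNReal.log (mgfHit K o z s))

/-- The odds of the steps of biased simple random walk on the integers from `x`: `1` of going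
left and `g` of going right. -/
def biasedOdds (g : ℝ) (x y : ℤ) : ℝ≥0∞ :=
  if y = x - 1 then 1 else if y = x + 1 then ENNReal.ofReal g else 0

theorem biasedOdds_tsum (g : ℝ) (x : ℤ) : ∑' y, biasedOdds g x y = 1 + ENNReal.ofReal g := by
  have h : ∀ y ∉ ({x - 1, x + 1} : Finset ℤ), biasedOdds g x y = 0 := by
    intro y hy
    simp only [Finset.mem_insert, Finset.mem_singleton, not_or] at hy
    simp [biasedOdds, hy.1, hy.2]
  have hne : x + 1 ≠ x - 1 := by omega
  rw [tsum_eq_sum h, Finset.sum_pair hne.symm]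
  simp [biasedOdds, hne]

/-- A step of biased simple random walk on the integers from `x`. -/
def biasedStep (g : ℝ) (x : ℤ) : PMF ℤ :=
  PMF.normalize (biasedOdds g x) (by simp [biasedOdds_tsum])
    (by simp [biasedOdds_tsum])

/-- The mean `m_g` of the time biased simple random walk takes from `0` to `1`. -/
def biasedMean (g : ℝ) : ℝ≥0∞ := meanHit (biasedStep g) 0 {1}

/-- The large deviation rate function `I_g` of the time biased simple random walk takes from
`0` to `1`. -/
def biasedRate (g a : ℝ) : EReal := rateHit (biasedStep g) 0 {1} a

/-- The lower bounds for the hitting time of `z` from `o`, with parameters `n` and `g`. -/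
def HitBounds {V : Type*} (G : WeightedGraph V) (o : V) (z : Set V) (n : ℕ) (g : ℝ) : Prop :=
  biasedMean g * n + 1 ≤ meanHit G.step o z ∧
  ∀ a : ℝ, ENNReal.ofReal a ≤ biasedMean g →
    probHitLE G.step o z (a * n + 1) ≤ EReal.exp (-(biasedRate g a * (n : EReal)))

end

/-! Write T for the hitting time from o, H(θ) = E θ^T, and φ = E θ^T' for the biased walk. Both
bounds follow from H(θ) ≤ θ φ^n for 0 < θ < 1 (`hitSeries_le_biased`): the mean by letting θ → 1,
the tail by Markov's inequality for θ^T.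

To bound H, bound its logarithmic derivative. Let a be the θ-discounted Green function with pole o,
killed on z, and h(x) = E_x θ^T. Then J(x,y) = w(x,y) a(x) h(y) is the expected number of steps from
x to y before T, weighted by θ^(T-1). Counting all steps gives D := θ H'(θ) = Σ_x w_x a(x) h(x)
(`tsum_visitSeries_mul_hitSeries`). The difference J(x,y) - J(y,x) is a flow of strength h(o)/θ from
o to z (`hasSum_flow`).

On an edge off z, J(x,y) / J(y,x) = v(x) / v(y) with v = a/h. So the traffic J(x,y) + J(y,x) is
(ρ+1)/(ρ-1) times the net flow, where ρ > 1 is the ratio of the values of v. The flow must climb n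
levels of the distance from o, and the weight of z limits how far v can drop on the way. As
(ρ+1)/(ρ-1) = coth(log ρ / 2) is convex in log ρ, it is cheapest to let v drop by the same factor q
at every level, as happens for a biased walk. `IsDiscountedPair.mean_ge` is the dual certificate:
the flow is tested against the potential -α κ - c log v, where κ is the distance and α, c come from
the tangent of coth at q. On the edges into z the logarithm is replaced by a tangent, which is
Jensen's inequality.

If H = θ ψ^n and w_z a(o) ≤ g^n, the choice q = g/ψ² yields D ≥ H (1 + n (g+ψ²)/(g-ψ²))
(`IsDiscountedPair.mean_ge_biased`). In case (b) the condition holds because a(o) is at most the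
effective resistance. In case (a), where it fails, the discounted number w_o a(o) of visits to o is
so large that the steps at o pay for giving up one level.

For the biased walk θ φ'/φ = (g+φ²)/(g-φ²) exactly, so the differential inequality integrates, back
from θ = 1, to ψ ≤ φ (`generatingFunction_le`). The formulas for m_g and I_g come from the quadratic
equation φ (1+g) = θ (φ²+g). -/

/-- The substochastic operator of the chain with steps `K`, killed on `z`. -/
noncomputable def killedStep {V : Type*} (K : V → PMF V) (z : Set V) (φ : V → ℝ≥0∞) : V → ℝ≥0∞ :=
  zᶜ.indicator fun x => ∑' y, K x y * φ y

theorem lintegral_toMeasure_top {V : Type*} (p : PMF V) (φ : V → ℝ≥0∞) :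
    letI : MeasurableSpace V := ⊤
    ∫⁻ y, φ y ∂p.toMeasure = ∑' y, p y * φ y := by
  let _ : MeasurableSpace V := ⊤
  have h : p.toMeasure = Measure.sum fun y => p y • Measure.dirac y := by
    ext s hs
    rw [PMF.toMeasure_apply _ hs, Measure.sum_apply _ hs]
    refine tsum_congr fun y => ?_
    by_cases hy : y ∈ s <;> simp [Measure.dirac_apply' _ hs, hy]
  rw [h, lintegral_sum_measure]
  refine tsum_congr fun y => ?_
  rw [lintegral_smul_measure, lintegral_dirac' _ measurable_from_top, smul_eq_mul]

/-! ### The law of the chain and its killed semigroup -/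

section chain

variable {V : Type*} (K : V → PMF V) (o : V)

theorem isProbabilityMeasure_chainLaw :
    letI := trajSpace V
    IsProbabilityMeasure (chainLaw K o) := by
  let _ : MeasurableSpace V := ⊤
  let k : Kernel V V := ⟨fun x => (K x).toMeasure, measurable_from_top⟩
  have : IsMarkovKernel k := ⟨fun x => PMF.toMeasure.isProbabilityMeasure (K x)⟩
  unfold chainLaw
  infer_instance

theorem lintegral_chainLaw_zero (φ : V → ℝ≥0∞) :
    letI := trajSpace V
    ∫⁻ ω, φ (ω 0) ∂chainLaw K o = φ o := by
  let _ : MeasurableSpace V := ⊤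
  let k : Kernel V V := ⟨fun x => (K x).toMeasure, measurable_from_top⟩
  have : IsMarkovKernel k := ⟨fun x => PMF.toMeasure.isProbabilityMeasure (K x)⟩
  have hφ : Measurable φ := measurable_from_top
  have h : (chainLaw K o).map (Preorder.frestrictLe (π := fun _ : ℕ => V) 0) =
      (Measure.dirac o).map (MeasurableEquiv.piUnique
        (fun i : Finset.Iic 0 => (fun _ : ℕ => V) i)).symm := by
    unfold chainLaw Kernel.trajMeasure
    rw [Measure.map_comp _ _ (by fun_prop), Kernel.traj_map_frestrictLe,
      Kernel.partialTraj_self, Measure.id_comp]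
  have e : ∫⁻ ω, φ (ω 0) ∂chainLaw K o = ∫⁻ u, φ (u ⟨0, Finset.mem_Iic.2 le_rfl⟩)
      ∂(chainLaw K o).map (Preorder.frestrictLe (π := fun _ : ℕ => V) 0) := by
    rw [lintegral_map (by fun_prop) (by fun_prop)]
    rfl
  rw [e, h, lintegral_map (by fun_prop) (by fun_prop), lintegral_dirac' _ (by fun_prop)]
  rfl

/-- The Markov property at time t, tested on an event of the past. The past is kept because survival
outside z has to be carried along. -/
theorem lintegral_chainLaw_succ (t : ℕ) (A : Set (Finset.Iic t → V))
    (hA : @MeasurableSet _ (@MeasurableSpace.pi _ (fun _ => V) (fun _ => ⊤)) A) (φ : V → ℝ≥0∞) :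
    letI := trajSpace V
    ∫⁻ ω, A.indicator 1 (Preorder.frestrictLe (π := fun _ : ℕ => V) t ω) * φ (ω (t + 1))
        ∂chainLaw K o =
      ∫⁻ ω, A.indicator 1 (Preorder.frestrictLe (π := fun _ : ℕ => V) t ω) *
        ∑' y, K (ω t) y * φ y ∂chainLaw K o := by
  let _ : MeasurableSpace V := ⊤
  let k : Kernel V V := ⟨fun x => (K x).toMeasure, measurable_from_top⟩
  have : IsMarkovKernel k := ⟨fun x => PMF.toMeasure.isProbabilityMeasure (K x)⟩
  have hφ : Measurable φ := measurable_from_top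
  have hK : Measurable fun x => ∑' y, K x y * φ y := measurable_from_top
  have hA' : Measurable (A.indicator (1 : (Finset.Iic t → V) → ℝ≥0∞)) :=
    measurable_one.indicator hA
  have key := Kernel.map_frestrictLe_trajMeasure_compProd_eq_map_trajMeasure
    (X := fun _ => V) (μ₀ := Measure.dirac o)
    (κ := fun n => k.comap (fun x => x ⟨n, Finset.mem_Iic.2 le_rfl⟩) (measurable_pi_apply _))
    (a := t)
  have e := congrArg (fun m => ∫⁻ p, A.indicator 1 p.1 * φ p.2 ∂m) key
  rw [lintegral_map (by fun_prop) (by fun_prop), Measure.lintegral_compProd (by fun_prop)] at e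
  have e' : ∀ u : Finset.Iic t → V, ∫⁻ y, A.indicator 1 u * φ y
      ∂(k.comap (fun x : Finset.Iic t → V => x ⟨t, Finset.mem_Iic.2 le_rfl⟩)
        (measurable_pi_apply _)) u =
      A.indicator 1 u * ∑' y, K (u ⟨t, Finset.mem_Iic.2 le_rfl⟩) y * φ y := fun u => by
    rw [lintegral_const_mul _ hφ, Kernel.comap_apply]
    congr 1
    exact lintegral_toMeasure_top _ φ
  refine e.symm.trans ((lintegral_congr e').trans ?_)
  exact lintegral_map (f := fun u : Finset.Iic t → V =>
    A.indicator 1 u * ∑' y, K (u ⟨t, Finset.mem_Iic.2 le_rfl⟩) y * φ y)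
    (hA'.mul (hK.comp (measurable_pi_apply _))) (by fun_prop)

/-- The expectation of `φ` at time `t` for the chain killed on `z`. -/
theorem lintegral_chainLaw_killed (z : Set V) (t : ℕ) (φ : V → ℝ≥0∞) :
    letI := trajSpace V
    ∫⁻ ω, {ω : ℕ → V | ∀ s < t, ω s ∉ z}.indicator 1 ω * φ (ω t) ∂chainLaw K o =
      (killedStep K z)^[t] φ o := by
  let _ : MeasurableSpace V := ⊤
  induction t generalizing φ with
  | zero => simpa using lintegral_chainLaw_zero K o φ
  | succ t ih =>
    rw [Function.iterate_succ_apply, ← ih]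
    have hA : MeasurableSet {u : Finset.Iic t → V | ∀ s, u s ∉ z} := by
      rw [Set.ofPred_forall]
      refine MeasurableSet.iInter fun s => ?_
      have : MeasurableSet ((fun u : Finset.Iic t → V => u s) ⁻¹' zᶜ) :=
        measurable_pi_apply s MeasurableSpace.measurableSet_top
      exact this
    have e := lintegral_chainLaw_succ K o t _ hA φ
    have hiff : ∀ ω : ℕ → V, (Preorder.frestrictLe (π := fun _ : ℕ => V) t ω ∈
        {u : Finset.Iic t → V | ∀ s, u s ∉ z}) ↔ ∀ s ≤ t, ω s ∉ z := fun ω =>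
      ⟨fun h s hs => h ⟨s, Finset.mem_Iic.2 hs⟩, fun h s => h s (Finset.mem_Iic.1 s.2)⟩
    refine Eq.trans ?_ (e.trans ?_)
    · refine lintegral_congr fun ω => ?_
      congr 1
      by_cases h : ∀ s ≤ t, ω s ∉ z
      · rw [Set.indicator_of_mem ((hiff ω).2 h), Set.indicator_of_mem
          (show ω ∈ {ω : ℕ → V | ∀ s < t + 1, ω s ∉ z} from fun s hs => h s (Nat.lt_succ_iff.1 hs))]
        rfl
      · rw [Set.indicator_of_notMem (mt (hiff ω).1 h), Set.indicator_of_notMem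
          (show ω ∉ {ω : ℕ → V | ∀ s < t + 1, ω s ∉ z} from fun h' => h fun s hs => h' s (Nat.lt_succ_iff.2 hs))]
    · refine lintegral_congr fun ω => ?_
      by_cases h : ∀ s ≤ t, ω s ∉ z
      · rw [Set.indicator_of_mem ((hiff ω).2 h), Set.indicator_of_mem
          (show ω ∈ {ω : ℕ → V | ∀ s < t, ω s ∉ z} from fun s hs => h s hs.le), killedStep,
          Set.indicator_of_mem (show ω t ∈ zᶜ from h t le_rfl)]
        rfl
      · rw [Set.indicator_of_notMem (mt (hiff ω).1 h)]
        by_cases h2 : ω t ∈ z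
        · rw [killedStep, Set.indicator_of_notMem (s := zᶜ) (not_not.2 h2), zero_mul, mul_zero]
        · rw [Set.indicator_of_notMem (s := {ω : ℕ → V | ∀ s < t, ω s ∉ z}), zero_mul, zero_mul]
          intro h1
          refine h fun s hs => ?_
          rcases hs.lt_or_eq with h' | rfl
          exacts [h1 s h', h2]

end chain

/-- The generating function of the time at which the chain with steps `K` hits `z`. -/
noncomputable def hitSeries {V : Type*} (K : V → PMF V) (z : Set V) (θ : ℝ≥0∞) (x : V) : ℝ≥0∞ :=
  ∑' t : ℕ, θ ^ t * (killedStep K z)^[t] (z.indicator 1) x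

/-! ### Distribution, transforms and Chernoff bound of the hitting time -/

section hitTime

variable {V : Type*} {z : Set V}

theorem hitTime_eq_coe_iff {ω : ℕ → V} {t : ℕ} :
    hitTime z ω = t ↔ (∀ s < t, ω s ∉ z) ∧ ω t ∈ z := by
  constructor
  · intro h
    have h1 : ∀ s < t, ω s ∉ z := fun s hs hz => by
      have : hitTime z ω ≤ s := iInf₂_le s hz
      rw [h, Nat.cast_le] at this
      omega
    refine ⟨h1, by_contra fun h2 => ?_⟩
    have : ((t + 1 : ℕ) : ℕ∞) ≤ hitTime z ω := le_iInf₂ fun k hk => by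
      rw [Nat.cast_le]
      by_contra hlt
      rcases (by omega : k < t ∨ k = t) with h' | rfl
      exacts [h1 k h' hk, h2 hk]
    rw [h, Nat.cast_le] at this
    omega
  · rintro ⟨h1, h2⟩
    refine le_antisymm (iInf₂_le t h2) (le_iInf₂ fun k hk => ?_)
    rw [Nat.cast_le]
    by_contra hlt
    exact h1 k (by omega) hk

theorem measurableSet_hitTime_eq (k : ℕ∞) : MeasurableSet[trajSpace V] {ω | hitTime z ω = k} := by
  let _ : MeasurableSpace V := ⊤
  have hfin : ∀ t : ℕ, MeasurableSet {ω : ℕ → V | hitTime z ω = t} := fun t => by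
    have : {ω : ℕ → V | hitTime z ω = t} =
        (⋂ s ∈ Set.Iio t, (fun ω : ℕ → V => ω s) ⁻¹' zᶜ) ∩ (fun ω : ℕ → V => ω t) ⁻¹' z := by
      ext ω
      rw [Set.mem_inter_iff, Set.mem_iInter₂]
      exact hitTime_eq_coe_iff
    rw [this]
    exact (MeasurableSet.biInter (Set.to_countable _) fun s _ =>
      measurable_pi_apply s MeasurableSpace.measurableSet_top).inter
        (measurable_pi_apply t MeasurableSpace.measurableSet_top)
  induction k using ENat.recTopCoe with
  | coe t => exact hfin t
  | top =>
    have : {ω : ℕ → V | hitTime z ω = ⊤} = (⋃ t : ℕ, {ω : ℕ → V | hitTime z ω = t})ᶜ := by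
      ext ω
      rw [Set.mem_compl_iff, Set.mem_iUnion]
      change hitTime z ω = ⊤ ↔ ¬ ∃ t : ℕ, hitTime z ω = t
      constructor
      · rintro h ⟨t, ht⟩
        exact ENat.natCast_ne_top t (ht.symm.trans h)
      · intro h
        by_contra h'
        obtain ⟨t, ht⟩ := ENat.ne_top_iff_exists.1 h'
        exact h ⟨t, ht.symm⟩
    rw [this]
    exact (MeasurableSet.iUnion hfin).compl

/-- A countable sum of indicators: both measurability and the integral of any function of the
hitting time are read off from it. -/
theorem comp_hitTime_eq (F : ℕ∞ → ℝ≥0∞) (ω : ℕ → V) :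
    F (hitTime z ω) = (∑' t : ℕ, {ω | hitTime z ω = t}.indicator (fun _ => F t) ω) +
      {ω | hitTime z ω = ⊤}.indicator (fun _ => F ⊤) ω := by
  have hmem : ∀ k : ℕ∞, hitTime z ω = k → ω ∈ {ω | hitTime z ω = k} := fun k h => h
  have hnot : ∀ k : ℕ∞, hitTime z ω ≠ k → ω ∉ {ω | hitTime z ω = k} := fun k h => h
  generalize hk : hitTime z ω = k at *
  induction k using ENat.recTopCoe with
  | coe t =>
    rw [Set.indicator_of_notMem (hnot _ (ENat.natCast_ne_top t)), tsum_eq_single t,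
      Set.indicator_of_mem (hmem _ rfl), add_zero]
    intro s hs
    exact Set.indicator_of_notMem (hnot _ (by simpa using hs.symm)) _
  | top =>
    rw [Set.indicator_of_mem (hmem _ rfl), ENNReal.tsum_eq_zero.2, zero_add]
    intro s
    exact Set.indicator_of_notMem (hnot _ (ENat.top_ne_natCast s)) _

theorem measurable_comp_hitTime (F : ℕ∞ → ℝ≥0∞) :
    letI := trajSpace V
    Measurable fun ω : ℕ → V => F (hitTime z ω) := by
  let := trajSpace V
  rw [funext (comp_hitTime_eq (z := z) F)]
  exact (Measurable.tsum fun t : ℕ =>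
    measurable_const.indicator (measurableSet_hitTime_eq (t : ℕ∞))).add
      (measurable_const.indicator (measurableSet_hitTime_eq ⊤))

variable (K : V → PMF V) (o : V)

theorem chainLaw_hitTime_eq (t : ℕ) :
    chainLaw K o {ω | hitTime z ω = t} = (killedStep K z)^[t] (z.indicator 1) o := by
  let := trajSpace V
  rw [← lintegral_chainLaw_killed, ← lintegral_indicator_one (measurableSet_hitTime_eq _)]
  refine lintegral_congr fun ω => ?_
  by_cases h1 : ∀ s < t, ω s ∉ z
  · rw [Set.indicator_of_mem (show ω ∈ {ω : ℕ → V | ∀ s < t, ω s ∉ z} from h1), Pi.one_apply,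
      one_mul]
    by_cases h2 : ω t ∈ z
    · rw [Set.indicator_of_mem h2, Set.indicator_of_mem
        (show ω ∈ {ω : ℕ → V | hitTime z ω = t} from hitTime_eq_coe_iff.2 ⟨h1, h2⟩)]
      rfl
    · rw [Set.indicator_of_notMem h2, Set.indicator_of_notMem
        (show ω ∉ {ω : ℕ → V | hitTime z ω = t} from fun h => h2 (hitTime_eq_coe_iff.1 h).2)]
  · rw [Set.indicator_of_notMem (show ω ∉ {ω : ℕ → V | ∀ s < t, ω s ∉ z} from h1), zero_mul,
      Set.indicator_of_notMem
        (show ω ∉ {ω : ℕ → V | hitTime z ω = t} from fun h => h1 (hitTime_eq_coe_iff.1 h).1)]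

theorem lintegral_comp_hitTime (F : ℕ∞ → ℝ≥0∞) :
    letI := trajSpace V
    ∫⁻ ω, F (hitTime z ω) ∂chainLaw K o =
      (∑' t : ℕ, F t * (killedStep K z)^[t] (z.indicator 1) o) +
        F ⊤ * chainLaw K o {ω | hitTime z ω = ⊤} := by
  let := trajSpace V
  rw [lintegral_congr (comp_hitTime_eq (z := z) F), lintegral_add_right _
    (measurable_const.indicator (measurableSet_hitTime_eq ⊤)), lintegral_tsum fun t : ℕ =>
    (measurable_const.indicator (measurableSet_hitTime_eq (t : ℕ∞))).aemeasurable]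
  simp_rw [lintegral_indicator_const (measurableSet_hitTime_eq _), chainLaw_hitTime_eq]

theorem hitSeries_one_add :
    hitSeries K z 1 o + chainLaw K o {ω | hitTime z ω = ⊤} = 1 := by
  let := trajSpace V
  have := isProbabilityMeasure_chainLaw K o
  have h := lintegral_comp_hitTime (z := z) K o 1
  simp only [Pi.one_apply, one_mul, lintegral_one, measure_univ] at h
  simpa [hitSeries] using h.symm

theorem exp_mul_coe (s : ℝ) (t : ℕ) :
    EReal.exp ((s : EReal) * (((t : ℕ∞) : ℝ≥0∞) : EReal)) = ENNReal.ofReal (Real.exp s) ^ t := by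
  have : (s : EReal) * (((t : ℕ∞) : ℝ≥0∞) : EReal) = ((t * s : ℝ) : EReal) := by
    rw [mul_comm]
    simp only [ENat.toENNReal_coe, EReal.coe_mul]
    rfl
  rw [this, EReal.exp_coe, Real.exp_nat_mul, ENNReal.ofReal_pow (Real.exp_pos s).le]

/-- The series misses the event that z is never hit. There the factor is 0, 1 or ∞ according to the
sign of s. -/
theorem mgfHit_eq (s : ℝ) : mgfHit K o z s = hitSeries K z (ENNReal.ofReal (Real.exp s)) o +
    EReal.exp ((s : EReal) * ⊤) * chainLaw K o {ω | hitTime z ω = ⊤} := by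
  let := trajSpace V
  rw [mgfHit, lintegral_comp_hitTime K o
    (fun k => EReal.exp ((s : EReal) * ((k : ℝ≥0∞) : EReal)))]
  simp_rw [exp_mul_coe, hitSeries]
  simp

theorem mgfHit_of_neg {s : ℝ} (hs : s < 0) :
    mgfHit K o z s = hitSeries K z (ENNReal.ofReal (Real.exp s)) o := by
  rw [mgfHit_eq, EReal.coe_mul_top_of_neg hs, EReal.exp_bot, zero_mul, add_zero]

theorem mgfHit_of_hitSeries_one (h : hitSeries K z 1 o = 1) (s : ℝ) :
    mgfHit K o z s = hitSeries K z (ENNReal.ofReal (Real.exp s)) o := by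
  have h' := hitSeries_one_add (z := z) K o
  rw [h] at h'
  have : chainLaw K o {ω | hitTime z ω = ⊤} = 0 := by
    simpa using (ENNReal.add_right_inj (a := 1) (b := _) (c := 0) (by simp)).1 (by simpa using h')
  rw [mgfHit_eq, this, mul_zero, add_zero]

theorem meanHit_eq : meanHit K o z = (∑' t : ℕ, t * (killedStep K z)^[t] (z.indicator 1) o) +
    ⊤ * chainLaw K o {ω | hitTime z ω = ⊤} := by
  let := trajSpace V
  rw [meanHit, lintegral_comp_hitTime K o (fun k => (k : ℝ≥0∞))]
  simp

/-- Bernoulli's inequality 1 + (θ-1) t ≤ θ^t, averaged over t. For θ < 1 it bounds the mean below by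
(1 - E θ^T)/(1 - θ); writing it without subtraction lets it hold for an infinite mean too. -/
theorem one_add_mul_meanHit_le (θ : ℝ≥0∞) :
    1 + θ * meanHit K o z ≤ hitSeries K z θ o + meanHit K o z := by
  by_cases h : chainLaw K o {ω | hitTime z ω = ⊤} = 0
  · have h1 := hitSeries_one_add (z := z) K o
    rw [h, add_zero] at h1
    rw [meanHit_eq, h, mul_zero, add_zero, ← h1]
    simp only [hitSeries]
    rw [← ENNReal.tsum_mul_left, ← ENNReal.tsum_add, ← ENNReal.tsum_add]
    refine ENNReal.tsum_le_tsum fun t => ?_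
    rw [← mul_assoc, ← add_mul, ← add_mul]
    refine mul_le_mul_left ?_ _
    rw [one_pow]
    rcases eq_or_ne θ ⊤ with rfl | hθ
    · rcases Nat.eq_zero_or_pos t with rfl | ht
      · simp
      · simp [ENNReal.top_pow ht.ne']
    lift θ to ℝ≥0 using hθ
    norm_cast
    have := one_add_mul_le_pow (a := (θ : ℝ) - 1) (by linarith [θ.2]) t
    rw [add_sub_cancel] at this
    have h2 : (1 : ℝ) + θ * t ≤ (θ : ℝ) ^ t + t := by linarith
    exact_mod_cast h2
  · rw [meanHit_eq, ENNReal.top_mul h]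
    simp

/-- Bernoulli's inequality on the other side of θ = 1, where an exponential moment bounds the mean
from above. -/
theorem one_add_mul_meanHit_le_of_hitSeries_one (h : hitSeries K z 1 o = 1) (δ : ℝ≥0∞) :
    1 + δ * meanHit K o z ≤ hitSeries K z (1 + δ) o := by
  have h' := hitSeries_one_add (z := z) K o
  rw [h] at h'
  have : chainLaw K o {ω | hitTime z ω = ⊤} = 0 := by
    simpa using (ENNReal.add_right_inj (a := 1) (b := _) (c := 0) (by simp)).1 (by simpa using h')
  rw [meanHit_eq, this, mul_zero, add_zero]
  nth_rw 1 [← h]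
  simp only [hitSeries]
  rw [← ENNReal.tsum_mul_left, ← ENNReal.tsum_add]
  refine ENNReal.tsum_le_tsum fun t => ?_
  rw [← mul_assoc, ← add_mul]
  gcongr
  rw [one_pow]
  rcases eq_or_ne δ ⊤ with rfl | hδ
  · rcases Nat.eq_zero_or_pos t with rfl | ht
    · simp
    · simp [ENNReal.top_pow ht.ne']
  lift δ to ℝ≥0 using hδ
  norm_cast
  have h2 := one_add_mul_le_pow (a := (δ : ℝ)) (by linarith [δ.2]) t
  rw [mul_comm] at h2
  exact_mod_cast h2

theorem probHitLE_le_one (t : ℝ) : probHitLE K o z t ≤ 1 := by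
  let := trajSpace V
  have := isProbabilityMeasure_chainLaw K o
  exact prob_le_one

/-- Chernoff's bound. A negative s makes trajectories that never hit z contribute nothing, so the
series alone appears. -/
theorem probHitLE_mul_exp_le {s : ℝ} (hs : s < 0) (t : ℝ) :
    ENNReal.ofReal (Real.exp (s * t)) * probHitLE K o z t ≤
      hitSeries K z (ENNReal.ofReal (Real.exp s)) o := by
  let := trajSpace V
  rw [← mgfHit_of_neg K o hs, mgfHit, probHitLE]
  refine le_trans ?_ (mul_meas_ge_le_lintegral (measurable_comp_hitTime
    (fun k => EReal.exp ((s : EReal) * ((k : ℝ≥0∞) : EReal))))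
    (ENNReal.ofReal (Real.exp (s * t))))
  gcongr with ω
  intro hω
  rw [← EReal.exp_coe]
  refine EReal.exp_monotone ?_
  generalize hitTime z ω = k at hω
  induction k using ENat.recTopCoe with
  | top => simp at hω
  | coe k =>
    have h1 : (((k : ℕ∞) : ℝ≥0∞) : EReal) = ((k : ℝ) : EReal) := by
      rw [ENat.toENNReal_coe]
      rfl
    rw [h1] at hω ⊢
    rw [← EReal.coe_mul, EReal.coe_le_coe_iff]
    exact mul_le_mul_of_nonpos_left (EReal.coe_le_coe_iff.1 hω) hs.le

end hitTime

/-! ### One-step equations of the killed walk -/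

section killedStep

variable {V : Type*} (K : V → PMF V) (z : Set V)

theorem killedStep_of_mem {x : V} (hx : x ∈ z) (φ : V → ℝ≥0∞) : killedStep K z φ x = 0 :=
  Set.indicator_of_notMem (not_not.2 hx) _

theorem killedStep_of_notMem {x : V} (hx : x ∉ z) (φ : V → ℝ≥0∞) :
    killedStep K z φ x = ∑' y, K x y * φ y :=
  Set.indicator_of_mem (show x ∈ zᶜ from hx) _

theorem killedStep_mono {φ ψ : V → ℝ≥0∞} (h : φ ≤ ψ) : killedStep K z φ ≤ killedStep K z ψ := by
  intro x
  by_cases hx : x ∈ z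
  · rw [killedStep_of_mem _ _ hx, killedStep_of_mem _ _ hx]
  · rw [killedStep_of_notMem _ _ hx, killedStep_of_notMem _ _ hx]
    exact ENNReal.tsum_le_tsum fun y => mul_le_mul_right (h y) _

theorem killedStep_const_mul (c : ℝ≥0∞) (φ : V → ℝ≥0∞) (x : V) :
    killedStep K z (fun y => c * φ y) x = c * killedStep K z φ x := by
  by_cases hx : x ∈ z
  · rw [killedStep_of_mem _ _ hx, killedStep_of_mem _ _ hx, mul_zero]
  · rw [killedStep_of_notMem _ _ hx, killedStep_of_notMem _ _ hx, ← ENNReal.tsum_mul_left]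
    exact tsum_congr fun y => by ring

theorem killedStep_tsum {ι : Type*} (φ : ι → V → ℝ≥0∞) (x : V) :
    killedStep K z (fun y => ∑' i, φ i y) x = ∑' i, killedStep K z (φ i) x := by
  by_cases hx : x ∈ z
  · simp [killedStep_of_mem _ _ hx]
  · simp_rw [killedStep_of_notMem _ _ hx, ← ENNReal.tsum_mul_left]
    exact ENNReal.tsum_comm

theorem killedStep_le_const {φ : V → ℝ≥0∞} {c : ℝ≥0∞} (h : ∀ x, φ x ≤ c) (x : V) :
    killedStep K z φ x ≤ c := by
  by_cases hx : x ∈ z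
  · simp [killedStep_of_mem _ _ hx]
  · rw [killedStep_of_notMem _ _ hx]
    calc ∑' y, K x y * φ y ≤ ∑' y, K x y * c := ENNReal.tsum_le_tsum fun y => mul_le_mul_right (h y) _
      _ = c := by rw [ENNReal.tsum_mul_right, PMF.tsum_coe, one_mul]

theorem iterate_killedStep_le_one {φ : V → ℝ≥0∞} (h : ∀ x, φ x ≤ 1) (t : ℕ) (x : V) :
    (killedStep K z)^[t] φ x ≤ 1 := by
  induction t generalizing x with
  | zero => exact h x
  | succ t ih =>
    rw [Function.iterate_succ_apply']
    exact killedStep_le_const K z ih x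

/-- The discounted occupation series of `φ` satisfies its one-step equation. -/
theorem tsum_pow_mul_iterate_killedStep (θ : ℝ≥0∞) (φ : V → ℝ≥0∞) (x : V) :
    ∑' t : ℕ, θ ^ t * (killedStep K z)^[t] φ x =
      φ x + θ * killedStep K z (fun y => ∑' t : ℕ, θ ^ t * (killedStep K z)^[t] φ y) x := by
  rw [tsum_eq_zero_add' ENNReal.summable, killedStep_tsum, ← ENNReal.tsum_mul_left]
  simp only [pow_zero, one_mul, Function.iterate_zero, id_eq]
  congr 1
  refine tsum_congr fun t => ?_
  rw [killedStep_const_mul, ← mul_assoc, ← pow_succ', Function.iterate_succ_apply']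

theorem hitSeries_eq (θ : ℝ≥0∞) (x : V) : hitSeries K z θ x =
    z.indicator 1 x + θ * killedStep K z (hitSeries K z θ) x :=
  tsum_pow_mul_iterate_killedStep K z θ _ x

/-- The generating function of the hitting time, restricted to times before `N`. -/
noncomputable def hitPartial (θ : ℝ≥0∞) (N : ℕ) (x : V) : ℝ≥0∞ :=
  ∑ t ∈ Finset.range N, θ ^ t * (killedStep K z)^[t] (z.indicator 1) x

theorem hitPartial_succ (θ : ℝ≥0∞) (N : ℕ) (x : V) : hitPartial K z θ (N + 1) x =
    z.indicator 1 x + θ * killedStep K z (hitPartial K z θ N) x := by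
  have h : hitPartial K z θ N = fun y => ∑' t : Finset.range N,
      θ ^ (t : ℕ) * (killedStep K z)^[t] (z.indicator 1) y := by
    funext y
    rw [Finset.tsum_subtype (Finset.range N)
      (fun t => θ ^ t * (killedStep K z)^[t] (z.indicator 1) y), hitPartial]
  rw [h, killedStep_tsum, Finset.tsum_subtype (Finset.range N)
    (fun t => killedStep K z (fun y => θ ^ t * (killedStep K z)^[t] (z.indicator 1) y) x),
    hitPartial, Finset.sum_range_succ', Finset.mul_sum, add_comm]
  simp only [pow_zero, one_mul, Function.iterate_zero, id_eq]
  congr 1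
  refine Finset.sum_congr rfl fun t _ => ?_
  rw [killedStep_const_mul, ← mul_assoc, ← pow_succ', Function.iterate_succ_apply']

theorem hitPartial_le (θ : ℝ≥0∞) (N : ℕ) (x : V) : hitPartial K z θ N x ≤ hitSeries K z θ x :=
  ENNReal.sum_le_tsum _

theorem hitSeries_eq_iSup (θ : ℝ≥0∞) (x : V) : hitSeries K z θ x = ⨆ N, hitPartial K z θ N x :=
  ENNReal.tsum_eq_iSup_nat

/-- The generating function of the hitting time is the least supersolution of the one-step
equation. -/
theorem hitSeries_le_of_supersolution (θ : ℝ≥0∞) (u : V → ℝ≥0∞)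
    (hu : ∀ x, z.indicator 1 x + θ * killedStep K z u x ≤ u x) (x : V) :
    hitSeries K z θ x ≤ u x := by
  rw [hitSeries_eq_iSup]
  refine iSup_le fun N => ?_
  induction N generalizing x with
  | zero => simp [hitPartial]
  | succ N ih =>
    rw [hitPartial_succ]
    refine le_trans ?_ (hu x)
    gcongr
    exact killedStep_mono K z ih x

theorem hitSeries_le_one {θ : ℝ≥0∞} (hθ : θ ≤ 1) (x : V) : hitSeries K z θ x ≤ 1 := by
  refine hitSeries_le_of_supersolution K z θ 1 (fun x => ?_) x
  by_cases hx : x ∈ z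
  · simp [killedStep_of_mem _ _ hx, hx]
  · rw [Set.indicator_of_notMem hx, zero_add]
    exact mul_le_one' hθ (killedStep_le_const K z (by simp) x)

theorem hitSeries_of_mem (θ : ℝ≥0∞) {x : V} (hx : x ∈ z) : hitSeries K z θ x = 1 := by
  rw [hitSeries_eq, killedStep_of_mem _ _ hx, Set.indicator_of_mem hx]
  simp

theorem hitSeries_of_notMem (θ : ℝ≥0∞) {x : V} (hx : x ∉ z) :
    hitSeries K z θ x = θ * ∑' y, K x y * hitSeries K z θ y := by
  rw [hitSeries_eq, killedStep_of_notMem _ _ hx, Set.indicator_of_notMem hx, zero_add]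

end killedStep

/-! ### Biased walk on the integers: the quadratic equation -/

section biased

variable (g : ℝ)

theorem tsum_biasedStep_mul (x : ℤ) (φ : ℤ → ℝ≥0∞) : ∑' y, biasedStep g x y * φ y =
    (φ (x - 1) + ENNReal.ofReal g * φ (x + 1)) / (1 + ENNReal.ofReal g) := by
  have h : ∀ y ∉ ({x - 1, x + 1} : Finset ℤ), biasedStep g x y * φ y = 0 := by
    intro y hy
    simp only [Finset.mem_insert, Finset.mem_singleton, not_or] at hy
    simp [biasedStep, biasedOdds, hy.1, hy.2]
  have hne : x + 1 ≠ x - 1 := by omega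
  rw [tsum_eq_sum h, Finset.sum_pair hne.symm]
  simp only [biasedStep, PMF.normalize_apply, biasedOdds_tsum]
  simp only [biasedOdds, if_true, if_neg hne, one_mul, ENNReal.div_eq_inv_mul]
  ring

theorem hitSeries_biased {x : ℤ} (hx : x ≤ 0) (θ : ℝ≥0∞) :
    hitSeries (biasedStep g) {1} θ x = θ * ((hitSeries (biasedStep g) {1} θ (x - 1) +
      ENNReal.ofReal g * hitSeries (biasedStep g) {1} θ (x + 1)) / (1 + ENNReal.ofReal g)) := by
  rw [hitSeries_of_notMem _ _ _ (show x ∉ ({1} : Set ℤ) by simp; omega), tsum_biasedStep_mul]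

theorem hitPartial_biased {x : ℤ} (hx : x ≤ 0) (θ : ℝ≥0∞) (N : ℕ) :
    hitPartial (biasedStep g) {1} θ (N + 1) x = θ * ((hitPartial (biasedStep g) {1} θ N (x - 1) +
      ENNReal.ofReal g * hitPartial (biasedStep g) {1} θ N (x + 1)) /
        (1 + ENNReal.ofReal g)) := by
  have h : x ∉ ({1} : Set ℤ) := by simp; omega
  rw [hitPartial_succ, killedStep_of_notMem _ _ h, Set.indicator_of_notMem h, zero_add,
    tsum_biasedStep_mul]

/-- To get from `x ≤ 0` to `1` the walk has to pass from `x` to `0`, then from `0` to `1`. -/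
theorem hitSeries_biased_mul {x : ℤ} (hx : x ≤ 0) (θ : ℝ≥0∞) :
    hitSeries (biasedStep g) {1} θ x =
      hitSeries (biasedStep g) {1} θ 0 * hitSeries (biasedStep g) {1} θ (x + 1) := by
  set X := hitSeries (biasedStep g) {1} θ with hX
  have h1 : X 1 = 1 := hitSeries_of_mem _ _ _ rfl
  apply le_antisymm
  -- Both inequalities go by induction on the truncation time N. For θ > 1 the series may be
  -- infinite, so a uniqueness argument by subtraction is not available.
  · rw [hX, hitSeries_eq_iSup _ _ _ x]
    refine iSup_le fun N => ?_
    induction N generalizing x with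
    | zero => simp [hitPartial]
    | succ N ih =>
      rcases hx.lt_or_eq with h | rfl
      · rw [hitPartial_biased g hx, ← hX, hX, hitSeries_biased g (x := x + 1) (by omega), ← hX]
        calc _ ≤ θ * ((X 0 * X (x - 1 + 1) + ENNReal.ofReal g * (X 0 * X (x + 1 + 1))) /
              (1 + ENNReal.ofReal g)) := by
              gcongr
              exacts [ih (by omega), ih (by omega)]
          _ = _ := by
              rw [show x - 1 + 1 = x + 1 - 1 by ring]
              simp only [ENNReal.div_eq_inv_mul]
              ring
      · rw [zero_add, ← hX, h1, mul_one]
        exact hitPartial_le _ _ _ _ _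
  · rw [hX, hitSeries_eq_iSup _ _ _ (x + 1), ← hX, ENNReal.mul_iSup]
    refine iSup_le fun N => ?_
    induction N generalizing x with
    | zero => simp [hitPartial]
    | succ N ih =>
      rcases hx.lt_or_eq with h | rfl
      · rw [hitPartial_biased g (x := x + 1) (by omega), hX, hitSeries_biased g hx, ← hX]
        calc _ = θ * ((X 0 * hitPartial (biasedStep g) {1} θ N (x - 1 + 1) + ENNReal.ofReal g *
              (X 0 * hitPartial (biasedStep g) {1} θ N (x + 1 + 1))) /
              (1 + ENNReal.ofReal g)) := by
              rw [show x - 1 + 1 = x + 1 - 1 by ring]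
              simp only [ENNReal.div_eq_inv_mul]
              ring
          _ ≤ _ := by
              gcongr
              exacts [ih (by omega), ih (by omega)]
      · rw [zero_add]
        calc _ ≤ X 0 * X 1 := mul_le_mul_right (hitPartial_le _ _ _ _ _) _
          _ = X 0 := by rw [h1, mul_one]

/-- The quadratic equation for the generating function of the time from `0` to `1`. -/
theorem hitSeries_biased_quadratic (θ : ℝ≥0∞) : hitSeries (biasedStep g) {1} θ 0 =
    θ * ((hitSeries (biasedStep g) {1} θ 0 ^ 2 + ENNReal.ofReal g) / (1 + ENNReal.ofReal g)) := by
  conv_lhs => rw [hitSeries_biased g le_rfl, hitSeries_biased_mul g (x := 0 - 1) (by norm_num)]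
  rw [show (0 : ℤ) - 1 + 1 = 0 by norm_num, zero_add,
    hitSeries_of_mem _ _ _ (show (1 : ℤ) ∈ ({1} : Set ℤ) from rfl), mul_one, sq]

/-- The generating function is at most any root of its quadratic equation. -/
theorem hitSeries_biased_le {θ φ : ℝ≥0∞}
    (h : θ * ((φ ^ 2 + ENNReal.ofReal g) / (1 + ENNReal.ofReal g)) ≤ φ) :
    hitSeries (biasedStep g) {1} θ 0 ≤ φ := by
  -- One factor φ for each unit step to the right that remains. To the right of 1 the walk never
  -- comes, and the value `⊤` makes the supersolution condition trivial there.
  let u : ℤ → ℝ≥0∞ := fun x => if x ≤ 1 then φ ^ (1 - x).toNat else ⊤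
  have hu : ∀ x, ({1} : Set ℤ).indicator 1 x + θ * killedStep (biasedStep g) {1} u x ≤ u x := by
    intro x
    by_cases h2 : x ≤ 1
    · rcases h2.lt_or_eq with h3 | rfl
      · have hx : x ∉ ({1} : Set ℤ) := by simp; omega
        rw [Set.indicator_of_notMem hx, zero_add, killedStep_of_notMem _ _ hx, tsum_biasedStep_mul]
        obtain ⟨k, rfl⟩ : ∃ k : ℕ, x = -k := ⟨(-x).toNat, by omega⟩
        have e1 : u (-k - 1) = φ ^ k * φ ^ 2 := by
          simp only [u]
          rw [if_pos (by omega), show (1 - (-(k : ℤ) - 1)).toNat = k + 2 by omega, pow_add]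
        have e2 : u (-k + 1) = φ ^ k := by
          simp only [u]
          rw [if_pos (by omega), show (1 - (-(k : ℤ) + 1)).toNat = k by omega]
        have e3 : u (-k) = φ ^ k * φ := by
          simp only [u]
          rw [if_pos (by omega), show (1 - (-(k : ℤ))).toNat = k + 1 by omega, pow_succ]
        rw [e1, e2, e3]
        calc _ = φ ^ k * (θ * ((φ ^ 2 + ENNReal.ofReal g) / (1 + ENNReal.ofReal g))) := by
              simp only [ENNReal.div_eq_inv_mul]
              ring
          _ ≤ _ := mul_le_mul_right h _
      · rw [killedStep_of_mem _ _ (show (1 : ℤ) ∈ ({1} : Set ℤ) from rfl)]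
        simp [u]
    · simp [u, h2]
  simpa [u] using hitSeries_le_of_supersolution _ _ θ u hu 0

end biased

/-! ### Mean and rate function of the biased walk -/

section biasedFormulas

variable {g : ℝ}

theorem ofReal_biased_quadratic (hg : 1 < g) {t φ : ℝ} (ht : 0 ≤ t) (hφ : 0 ≤ φ) :
    ENNReal.ofReal t * ((ENNReal.ofReal φ ^ 2 + ENNReal.ofReal g) / (1 + ENNReal.ofReal g)) =
      ENNReal.ofReal (t * ((φ ^ 2 + g) / (1 + g))) := by
  rw [← ENNReal.ofReal_pow hφ, ← ENNReal.ofReal_add (by positivity) (by linarith),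
    ← ENNReal.ofReal_one, ← ENNReal.ofReal_add (by norm_num) (by linarith),
    ← ENNReal.ofReal_div_of_pos (by linarith), ← ENNReal.ofReal_mul ht]

theorem toReal_hitSeries_biased (hg : 1 < g) {t : ℝ} (ht : 0 < t)
    (hX : hitSeries (biasedStep g) {1} (ENNReal.ofReal t) 0 ≠ ⊤) :
    0 < (hitSeries (biasedStep g) {1} (ENNReal.ofReal t) 0).toReal ∧
    (hitSeries (biasedStep g) {1} (ENNReal.ofReal t) 0).toReal * (1 + g) =
      t * ((hitSeries (biasedStep g) {1} (ENNReal.ofReal t) 0).toReal ^ 2 + g) := by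
  have h := hitSeries_biased_quadratic g (ENNReal.ofReal t)
  generalize hitSeries (biasedStep g) {1} (ENNReal.ofReal t) 0 = X at h hX
  have hx := ENNReal.ofReal_toReal hX
  have h0 : 0 ≤ X.toReal := ENNReal.toReal_nonneg
  generalize X.toReal = x at hx h0
  subst hx
  rw [ofReal_biased_quadratic hg ht.le h0] at h
  have h1 : x = t * ((x ^ 2 + g) / (1 + g)) := by
    rwa [ENNReal.ofReal_eq_ofReal_iff h0 (by positivity)] at h
  have h2 : x * (1 + g) = t * (x ^ 2 + g) := by
    have : (1 : ℝ) + g ≠ 0 := by positivity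
    field_simp at h1
    linarith
  refine ⟨?_, h2⟩
  rw [h1]
  positivity

/-- The quadratic is linear in θ: it is simpler to choose the root φ and to compute θ from it, which
avoids square roots and the question of which root φ is. -/
theorem hitSeries_biased_le_ofReal (hg : 1 < g) {φ : ℝ} (hφ : 0 < φ) :
    hitSeries (biasedStep g) {1} (ENNReal.ofReal (φ * (1 + g) / (φ ^ 2 + g))) 0 ≤
      ENNReal.ofReal φ := by
  refine hitSeries_biased_le g ?_
  rw [ofReal_biased_quadratic hg (by positivity) hφ.le]
  refine ENNReal.ofReal_le_ofReal (le_of_eq ?_)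
  have : (1 : ℝ) + g ≠ 0 := by positivity
  have : φ ^ 2 + g ≠ 0 := by positivity
  field_simp

/-- At θ = 1 the quadratic has the roots 1 and g, and a probability cannot be g > 1. So 1 is hit
almost surely. -/
theorem hitSeries_biased_one (hg : 1 < g) : hitSeries (biasedStep g) {1} 1 0 = 1 := by
  have h1 := hitSeries_le_one (biasedStep g) {1} (le_refl 1) 0
  have htop : hitSeries (biasedStep g) {1} 1 0 ≠ ⊤ := ne_top_of_le_ne_top ENNReal.one_ne_top h1
  have h := toReal_hitSeries_biased hg (t := 1) one_pos (by simpa using htop)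
  rw [ENNReal.ofReal_one] at h
  have h2 : (hitSeries (biasedStep g) {1} 1 0).toReal ≤ 1 :=
    ENNReal.toReal_le_of_le_ofReal zero_le_one (by simpa using h1)
  obtain ⟨_, h3⟩ := h
  have h4 : ((hitSeries (biasedStep g) {1} 1 0).toReal - 1) *
      ((hitSeries (biasedStep g) {1} 1 0).toReal - g) = 0 := by nlinarith
  have h5 : (hitSeries (biasedStep g) {1} 1 0).toReal = 1 := by
    rcases mul_eq_zero.1 h4 with h5 | h5 <;> linarith
  rw [← ENNReal.ofReal_toReal htop, h5, ENNReal.ofReal_one]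

theorem mgfHit_biased (hg : 1 < g) (s : ℝ) : mgfHit (biasedStep g) 0 {1} s =
    hitSeries (biasedStep g) {1} (ENNReal.ofReal (Real.exp s)) 0 :=
  mgfHit_of_hitSeries_one _ _ (hitSeries_biased_one hg) s

/-- With θ given by the root φ, the difference quotient (φ-1)/(θ-1) is (φ²+g)/(g-φ). The two
Bernoulli bounds place the mean below it for φ > 1 and above it for φ < 1; then φ → 1. -/
theorem biasedMean_eq (hg : 1 < g) : biasedMean g = ENNReal.ofReal ((g + 1) / (g - 1)) := by
  have hup : ∀ φ, 1 < φ → φ < g → biasedMean g ≤ ENNReal.ofReal ((φ ^ 2 + g) / (g - φ)) := by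
    intro φ h1 h2
    have hδ : 0 < (φ - 1) * (g - φ) / (φ ^ 2 + g) :=
      div_pos (mul_pos (by linarith) (by linarith)) (by positivity)
    have h := one_add_mul_meanHit_le_of_hitSeries_one _ _ (hitSeries_biased_one hg)
      (ENNReal.ofReal ((φ - 1) * (g - φ) / (φ ^ 2 + g)))
    have e : 1 + (φ - 1) * (g - φ) / (φ ^ 2 + g) = φ * (1 + g) / (φ ^ 2 + g) := by
      have : φ ^ 2 + g ≠ 0 := by positivity
      field_simp
      ring
    have h' : 1 + ENNReal.ofReal ((φ - 1) * (g - φ) / (φ ^ 2 + g)) * biasedMean g ≤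
        ENNReal.ofReal φ := by
      refine h.trans ?_
      rw [← ENNReal.ofReal_one, ← ENNReal.ofReal_add zero_le_one hδ.le, e]
      exact hitSeries_biased_le_ofReal hg (by linarith)
    have h3 : ENNReal.ofReal ((φ - 1) * (g - φ) / (φ ^ 2 + g)) * biasedMean g ≤
        ENNReal.ofReal (φ - 1) := by
      rw [ENNReal.ofReal_sub _ zero_le_one, ENNReal.ofReal_one]
      exact ENNReal.le_sub_of_add_le_left ENNReal.one_ne_top h'
    rw [mul_comm, ← ENNReal.le_div_iff_mul_le (Or.inl (by simpa using hδ))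
      (Or.inl ENNReal.ofReal_ne_top), ← ENNReal.ofReal_div_of_pos hδ] at h3
    convert h3 using 2
    have : φ - 1 ≠ 0 := by linarith
    have : g - φ ≠ 0 := by linarith
    field_simp
  have hfin : biasedMean g ≠ ⊤ :=
    ne_top_of_le_ne_top ENNReal.ofReal_ne_top (hup ((1 + g) / 2) (by linarith) (by linarith))
  have hlow : ∀ φ, 0 < φ → φ < 1 → (φ ^ 2 + g) / (g - φ) ≤ (biasedMean g).toReal := by
    intro φ h1 h2
    have h := (one_add_mul_meanHit_le (z := {1}) (biasedStep g) 0
      (ENNReal.ofReal (φ * (1 + g) / (φ ^ 2 + g)))).trans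
        (add_le_add_left (hitSeries_biased_le_ofReal hg h1) _)
    change 1 + _ * biasedMean g ≤ _ + biasedMean g at h
    rw [← ENNReal.ofReal_toReal hfin, ← ENNReal.ofReal_one, ← ENNReal.ofReal_mul (by positivity),
      ← ENNReal.ofReal_add zero_le_one (by positivity),
      ← ENNReal.ofReal_add h1.le ENNReal.toReal_nonneg,
      ENNReal.ofReal_le_ofReal_iff (by positivity)] at h
    have h3 : 0 < g - φ := by linarith
    have h4 : 0 < φ ^ 2 + g := by positivity
    rw [div_le_iff₀ h3]
    have h5 : (1 - φ) * (φ ^ 2 + g) ≤ (1 - φ) * ((biasedMean g).toReal * (g - φ)) := by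
      have e : φ * (1 + g) / (φ ^ 2 + g) * (biasedMean g).toReal =
        φ * (1 + g) * (biasedMean g).toReal / (φ ^ 2 + g) := by ring
      rw [e, ← le_sub_iff_add_le', div_le_iff₀ h4] at h
      nlinarith
    exact le_of_mul_le_mul_left h5 (by linarith)
  rw [← ENNReal.ofReal_toReal hfin]
  congr 1
  have hc : Filter.Tendsto (fun φ : ℝ => (φ ^ 2 + g) / (g - φ)) (nhds 1)
      (nhds ((g + 1) / (g - 1))) := by
    have : ContinuousAt (fun φ : ℝ => (φ ^ 2 + g) / (g - φ)) 1 := by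
      refine ContinuousAt.div (by fun_prop) (by fun_prop) (by linarith)
    convert this.tendsto using 2
    ring
  apply le_antisymm
  · refine ge_of_tendsto (hc.mono_left (nhdsWithin_le_nhds (s := Set.Ioi 1))) ?_
    filter_upwards [Ioo_mem_nhdsGT hg] with φ hφ
    exact ENNReal.toReal_le_of_le_ofReal
      (div_nonneg (by nlinarith [sq_nonneg φ]) (by linarith [hφ.2])) (hup φ hφ.1 hφ.2)
  · refine le_of_tendsto (hc.mono_left (nhdsWithin_le_nhds (s := Set.Iio 1))) ?_
    filter_upwards [Ioo_mem_nhdsLT zero_lt_one] with φ hφ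
    exact hlow φ hφ.1 hφ.2

/-- The value of the rate function of biased simple random walk. -/
noncomputable def biasedRateValue (g a : ℝ) : ℝ :=
  a * Real.log (1 + g) + (a - 1) / 2 * Real.log (a - 1) + (a + 1) / 2 * Real.log (a + 1) -
    a * Real.log (2 * a) - (a + 1) / 2 * Real.log g

/-- Concavity of the logarithm with weights (a-1)/(2a) and (a+1)/(2a), with equality at y =
g(a-1)/(a+1). With y = x² this is the optimization in the Legendre transform. -/
theorem mul_log_add_ge {a y : ℝ} (hg : 0 < g) (ha : 1 < a) (hy : 0 < y) :
    (a - 1) / 2 * Real.log y + (a + 1) / 2 * Real.log g + a * Real.log (2 * a) -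
      (a - 1) / 2 * Real.log (a - 1) - (a + 1) / 2 * Real.log (a + 1) ≤
      a * Real.log (y + g) := by
  have h1 : Real.log (2 * a * y / ((a - 1) * (y + g))) ≤ 2 * a * y / ((a - 1) * (y + g)) - 1 :=
    Real.log_le_sub_one_of_pos (div_pos (by positivity) (mul_pos (by linarith) (by positivity)))
  have h2 : Real.log (2 * a * g / ((a + 1) * (y + g))) ≤ 2 * a * g / ((a + 1) * (y + g)) - 1 :=
    Real.log_le_sub_one_of_pos (by positivity)
  have ha1 : a - 1 ≠ 0 := by linarith
  have hyg : y + g ≠ 0 := by positivity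
  rw [Real.log_div (by positivity) (by positivity), Real.log_mul (by positivity) (by positivity),
    Real.log_mul ha1 hyg] at h1
  rw [Real.log_div (by positivity) (by positivity), Real.log_mul (by positivity) (by positivity),
    Real.log_mul (by positivity) hyg] at h2
  have h3 := mul_le_mul_of_nonneg_left h1 (show 0 ≤ (a - 1) / 2 by linarith)
  have h4 := mul_le_mul_of_nonneg_left h2 (show 0 ≤ (a + 1) / 2 by linarith)
  have e1 : (a - 1) / 2 * (2 * a * y / ((a - 1) * (y + g)) - 1) +
      (a + 1) / 2 * (2 * a * g / ((a + 1) * (y + g)) - 1) = 0 := by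
    field_simp
    ring
  nlinarith

/-- The quadratic gives s = log x + log(1+g) - log(x²+g) in terms of the generating function x, so
the Legendre transform becomes an optimization over x, solved by `mul_log_add_ge`. -/
theorem biasedRate_eq (hg : 1 < g) {a : ℝ} (ha : 1 < a) :
    biasedRate g a = (biasedRateValue g a : EReal) := by
  have hlog : ∀ x : ℝ, 0 < x → Real.log x = Real.log (x ^ 2) / 2 := fun x _ => by
    rw [Real.log_pow]
    push_cast
    ring
  unfold biasedRate rateHit
  apply le_antisymm
  · refine iSup_le fun s => ?_
    rw [mgfHit_biased hg]
    by_cases hX : hitSeries (biasedStep g) {1} (ENNReal.ofReal (Real.exp s)) 0 = ⊤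
    · rw [hX]
      simp
    · obtain ⟨hx, hq⟩ := toReal_hitSeries_biased hg (Real.exp_pos s) hX
      rw [← ENNReal.ofReal_toReal hX, ENNReal.log_ofReal_of_pos hx, ← EReal.coe_sub,
        EReal.coe_le_coe_iff]
      generalize (hitSeries (biasedStep g) {1} (ENNReal.ofReal (Real.exp s)) 0).toReal = x at hx hq
      have hs : Real.log x + Real.log (1 + g) = s + Real.log (x ^ 2 + g) := by
        have := congrArg Real.log hq
        rwa [Real.log_mul hx.ne' (by positivity), Real.log_mul (Real.exp_pos s).ne' (by positivity),
          Real.log_exp] at this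
      have h := mul_log_add_ge (by linarith : 0 < g) ha (show 0 < x ^ 2 by positivity)
      have hl := hlog x hx
      have e : s = Real.log x + Real.log (1 + g) - Real.log (x ^ 2 + g) := by linarith
      unfold biasedRateValue
      rw [e]
      rw [show Real.log (x ^ 2) = 2 * Real.log x by linarith] at h
      nlinarith
  -- The equality case of `mul_log_add_ge`. An upper bound for the generating function suffices
  -- here.
  · set φ : ℝ := Real.sqrt (g * (a - 1) / (a + 1)) with hφdef
    have hpos : 0 < g * (a - 1) / (a + 1) :=
      div_pos (mul_pos (by linarith) (by linarith)) (by linarith)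
    have hφ : 0 < φ := Real.sqrt_pos.2 hpos
    have hφ2 : φ ^ 2 = g * (a - 1) / (a + 1) := Real.sq_sqrt hpos.le
    have hφg : φ ^ 2 + g = 2 * a * g / (a + 1) := by
      rw [hφ2]
      field_simp
      ring
    set t : ℝ := φ * (1 + g) / (φ ^ 2 + g) with ht
    have htpos : 0 < t := by positivity
    have hle : hitSeries (biasedStep g) {1} (ENNReal.ofReal t) 0 ≤ ENNReal.ofReal φ :=
      hitSeries_biased_le_ofReal hg hφ
    refine le_trans ?_ (le_iSup _ (Real.log t))
    rw [mgfHit_biased hg, Real.exp_log htpos]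
    have h1 : ENNReal.log (hitSeries (biasedStep g) {1} (ENNReal.ofReal t) 0) ≤ Real.log φ := by
      rw [← ENNReal.log_ofReal_of_pos hφ]
      exact ENNReal.log_monotone hle
    refine le_trans ?_ (EReal.sub_le_sub le_rfl h1)
    rw [← EReal.coe_sub, EReal.coe_le_coe_iff]
    refine le_of_eq ?_
    have e1 : Real.log φ = (Real.log g + Real.log (a - 1) - Real.log (a + 1)) / 2 := by
      rw [hlog φ hφ, hφ2, Real.log_div (mul_pos (by linarith) (by linarith)).ne' (by linarith),
        Real.log_mul (by linarith) (by linarith)]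
    have e2 : Real.log t = Real.log φ + Real.log (1 + g) -
        (Real.log (2 * a) + Real.log g - Real.log (a + 1)) := by
      rw [ht, Real.log_div (by positivity) (by positivity), Real.log_mul (by positivity)
        (by positivity), hφg, Real.log_div (by positivity) (by linarith),
        Real.log_mul (by linarith) (by linarith)]
    rw [e2, e1, biasedRateValue]
    ring

theorem exp_neg_biasedRate (hg : 1 < g) {a : ℝ} (ha : 1 < a) :
    EReal.exp (-biasedRate g a) =
      ENNReal.ofReal (g / (a + 1) * (g / (a ^ 2 - 1)) ^ ((a - 1) / 2) * (2 * a / (g + 1)) ^ a) := by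
  rw [biasedRate_eq hg ha, ← EReal.coe_neg, EReal.exp_coe]
  congr 1
  have h1 : 0 < a ^ 2 - 1 := by nlinarith
  have hE : 0 < g / (a + 1) * (g / (a ^ 2 - 1)) ^ ((a - 1) / 2) * (2 * a / (g + 1)) ^ a := by
    positivity
  rw [← Real.exp_log hE]
  congr 1
  have h2 : a ^ 2 - 1 = (a - 1) * (a + 1) := by ring
  have h3 : a - 1 ≠ 0 := by linarith
  rw [Real.log_mul (by positivity) (by positivity), Real.log_mul (by positivity) (by positivity),
    Real.log_rpow (by positivity), Real.log_rpow (by positivity),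
    Real.log_div (by positivity) (by positivity), Real.log_div (by positivity) (by positivity),
    Real.log_div (by positivity) (by positivity), h2, Real.log_mul h3 (by positivity),
    biasedRateValue, add_comm g 1]
  ring

end biasedFormulas

/-! ### The flow from the pole to the target set -/

/-- The discounted Green function `a` with pole `o` and the discounted hitting function `h` of the
random walk with weights `w` killed on `z`, characterized by their one-step equations. -/
structure IsDiscountedPair {V : Type*} (w : V → V → ℝ) (W : V → ℝ) (z : Set V) (o : V) (θ : ℝ)
    (a h : V → ℝ) : Prop where
  nonneg : ∀ x y, 0 ≤ w x y
  symm : ∀ x y, w x y = w y x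
  hasSum : ∀ x, HasSum (w x) (W x)
  pole : o ∉ z
  discount_pos : 0 < θ
  a_nonneg : ∀ x, 0 ≤ a x
  h_nonneg : ∀ x, 0 ≤ h x
  h_le_one : ∀ x, h x ≤ 1
  a_of_mem : ∀ x ∈ z, a x = 0
  h_of_mem : ∀ x ∈ z, h x = 1
  h_le : ∀ x ∉ z, h x ≤ θ
  h_step : ∀ x ∉ z, HasSum (fun y => w x y * h y) (W x * h x / θ)
  a_step : ∀ x ∉ z, x ≠ o → HasSum (fun y => w x y * a y) (W x * a x / θ)
  a_step_pole : HasSum (fun y => w o y * a y) ((W o * a o - 1) / θ)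
  summable : Summable fun x => W x * a x

/-- Truncation to [-M, M] is monotone and 1-Lipschitz. It makes the potential bounded, so that
summation by parts is legitimate, without enlarging its increments. -/
theorem max_min_sub_le (M p q : ℝ) :
    max (-M) (min p M) - max (-M) (min q M) ≤ max 0 (p - q) := by
  rcases le_total p q with h | h
  · have : max (-M) (min p M) ≤ max (-M) (min q M) := max_le_max le_rfl (min_le_min h le_rfl)
    exact le_max_of_le_left (by linarith)
  · refine le_max_of_le_right ?_
    rw [sub_le_iff_le_add]
    refine max_le ?_ ?_
    · linarith [le_max_left (-M) (min q M)]
    · rcases le_total q M with h1 | h1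
      · linarith [le_max_right (-M) (min q M), min_eq_left h1, min_le_left p M]
      · linarith [le_max_right (-M) (min q M), min_eq_right h1, min_le_right p M]

theorem hasSum_of_eq {ι : Type*} {F F' : ι → ℝ} {s s' : ℝ} (h : HasSum F s)
    (hF : ∀ i, F' i = F i) (hs : s' = s) : HasSum F' s' := by
  rw [hs, funext hF]
  exact h

/-- Only the two orientations of an edge together need to be compared, as traffic in one direction
may be too small. -/
theorem HasSum.le_of_add_swap_le {V : Type*} {F B : V × V → ℝ} {s b : ℝ} (hF : HasSum F s)
    (hB : HasSum B b) (h : ∀ p, B p + B p.swap ≤ F p + F p.swap) : b ≤ s := by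
  have hF' : HasSum (fun p : V × V => F p.swap) s := (Equiv.prodComm V V).hasSum_iff.2 hF
  have hB' : HasSum (fun p : V × V => B p.swap) b := (Equiv.prodComm V V).hasSum_iff.2 hB
  have := hasSum_le h (hB.add hB') (hF.add hF')
  linarith

namespace IsDiscountedPair

variable {V : Type*} {w : V → V → ℝ} {W : V → ℝ} {z : Set V} {o : V} {θ : ℝ} {a h : V → ℝ}
  (P : IsDiscountedPair w W z o θ a h)

include P

theorem W_nonneg (x : V) : 0 ≤ W x := (P.hasSum x).nonneg (P.nonneg x)

theorem a_pole_pos : 0 < a o := by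
  have h1 : 0 ≤ (W o * a o - 1) / θ :=
    P.a_step_pole.nonneg fun y => mul_nonneg (P.nonneg _ _) (P.a_nonneg _)
  have h2 : 0 ≤ W o * a o - 1 := by
    by_contra hneg
    exact absurd (div_neg_of_neg_of_pos (not_le.1 hneg) P.discount_pos) (not_lt.2 h1)
  refine (P.a_nonneg o).lt_of_ne fun h0 => ?_
  rw [← h0] at h2
  linarith

/-- Minimum principle: where the nonnegative function vanishes, its one-step equation forces every
neighbouring term to vanish. -/
theorem h_ne_zero {x y : V} (hx : x ∉ z) (hw : w x y ≠ 0) (hy : h y ≠ 0) : h x ≠ 0 := by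
  intro h0
  have h1 := P.h_step x hx
  rw [h0, mul_zero, zero_div] at h1
  have h2 := le_hasSum h1 y fun _ _ => mul_nonneg (P.nonneg _ _) (P.h_nonneg _)
  exact mul_ne_zero hw hy (le_antisymm h2 (mul_nonneg (P.nonneg _ _) (P.h_nonneg _)))

theorem a_ne_zero {x y : V} (hx : x ∉ z) (hw : w x y ≠ 0) (hy : a y ≠ 0) : a x ≠ 0 := by
  intro h0
  have hxo : x ≠ o := fun e => P.a_pole_pos.ne' (e ▸ h0)
  have h1 := P.a_step x hx hxo
  rw [h0, mul_zero, zero_div] at h1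
  have h2 := le_hasSum h1 y fun _ _ => mul_nonneg (P.nonneg _ _) (P.a_nonneg _)
  exact mul_ne_zero hw hy (le_antisymm h2 (mul_nonneg (P.nonneg _ _) (P.a_nonneg _)))

theorem hasSum_row (x : V) : HasSum (fun y => w x y * a x * h y) (W x * a x * h x / θ) := by
  by_cases hx : x ∈ z
  · simpa [P.a_of_mem x hx] using hasSum_zero
  · exact hasSum_of_eq ((P.h_step x hx).mul_left (a x)) (fun y => by ring) (by ring)

theorem summable_prod : Summable fun p : V × V => w p.1 p.2 * a p.1 * h p.2 := by
  have h0 : Summable fun p : V × V => w p.1 p.2 * a p.1 := by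
    refine (summable_prod_of_nonneg (f := fun p : V × V => w p.1 p.2 * a p.1)
      fun p => mul_nonneg (P.nonneg _ _) (P.a_nonneg _)).2
      ⟨fun x => (P.hasSum x).summable.mul_right (a x), ?_⟩
    exact P.summable.congr fun x => ((P.hasSum x).mul_right (a x)).tsum_eq.symm
  refine h0.of_nonneg_of_le (fun p => mul_nonneg (mul_nonneg (P.nonneg _ _) (P.a_nonneg _))
    (P.h_nonneg _)) fun p => ?_
  exact mul_le_of_le_one_right (mul_nonneg (P.nonneg _ _) (P.a_nonneg _)) (P.h_le_one _)

theorem hasSum_prod : HasSum (fun p : V × V => w p.1 p.2 * a p.1 * h p.2)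
    ((∑' x, W x * a x * h x) / θ) := by
  have := P.summable_prod.hasSum
  rwa [P.summable_prod.tsum_prod' fun x => (P.hasSum_row x).summable,
    tsum_congr fun x => (P.hasSum_row x).tsum_eq, tsum_div_const] at this

/-- Summation by parts for the flow `w x y * (a x * h y - a y * h x)`. -/
theorem hasSum_flow (Ψ : V → ℝ) (M : ℝ) (hΨ : ∀ x, |Ψ x| ≤ M) (hz : ∀ x ∈ z, Ψ x = 0) :
    HasSum (fun p : V × V => w p.1 p.2 * a p.1 * h p.2 * (Ψ p.1 - Ψ p.2)) (Ψ o * h o / θ) := by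
  have hJ0 : ∀ p : V × V, 0 ≤ w p.1 p.2 * a p.1 * h p.2 := fun p =>
    mul_nonneg (mul_nonneg (P.nonneg _ _) (P.a_nonneg _)) (P.h_nonneg _)
  have s1 : Summable fun p : V × V => w p.1 p.2 * a p.1 * h p.2 * Ψ p.1 := by
    refine Summable.of_norm_bounded (P.summable_prod.mul_right M) fun p => ?_
    rw [norm_mul, Real.norm_of_nonneg (hJ0 p)]
    exact mul_le_mul_of_nonneg_left (hΨ _) (hJ0 p)
  have s2 : Summable fun p : V × V => w p.1 p.2 * a p.1 * h p.2 * Ψ p.2 := by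
    refine Summable.of_norm_bounded (P.summable_prod.mul_right M) fun p => ?_
    rw [norm_mul, Real.norm_of_nonneg (hJ0 p)]
    exact mul_le_mul_of_nonneg_left (hΨ _) (hJ0 p)
  have s2' : Summable fun p : V × V => w p.2 p.1 * a p.2 * h p.1 * Ψ p.1 :=
    (Equiv.prodComm V V).summable_iff.2 s2
  have e2 : ∑' p : V × V, w p.1 p.2 * a p.1 * h p.2 * Ψ p.2 =
      ∑' p : V × V, w p.2 p.1 * a p.2 * h p.1 * Ψ p.1 :=
    ((Equiv.prodComm V V).tsum_eq fun p : V × V => w p.1 p.2 * a p.1 * h p.2 * Ψ p.2).symm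
  -- Outgoing traffic is computed from the equation of `h`, incoming traffic from that of `a`. They
  -- cancel at every vertex but the pole, where `a` has its unit source; on z the vanishing of Ψ
  -- takes over.
  have r1 : ∀ x, HasSum (fun y => w x y * a x * h y * Ψ x) (W x * a x * h x / θ * Ψ x) :=
    fun x => (P.hasSum_row x).mul_right _
  have r2 : ∀ x, x ≠ o → HasSum (fun y => w y x * a y * h x * Ψ x) (W x * a x * h x / θ * Ψ x) := by
    intro x hxo
    by_cases hx : x ∈ z
    · simpa [hz x hx] using hasSum_zero
    · exact hasSum_of_eq ((P.a_step x hx hxo).mul_right (h x * Ψ x))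
        (fun y => by rw [P.symm y x]; ring) (by ring)
  have r2o : HasSum (fun y => w y o * a y * h o * Ψ o)
      (W o * a o * h o / θ * Ψ o - Ψ o * h o / θ) :=
    hasSum_of_eq (P.a_step_pole.mul_right (h o * Ψ o))
      (fun y => by rw [P.symm y o]; ring) (by ring)
  have key : HasSum (fun x => ∑' y, (w x y * a x * h y * Ψ x - w y x * a y * h x * Ψ x))
      (Ψ o * h o / θ) := by
    refine hasSum_of_eq (hasSum_single (f := fun x =>
      ∑' y, (w x y * a x * h y * Ψ x - w y x * a y * h x * Ψ x)) o fun x hx => ?_) (fun _ => rfl) ?_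
    · rw [((r1 x).sub (r2 x hx)).tsum_eq, sub_self]
    · rw [((r1 o).sub r2o).tsum_eq]
      ring
  have s3 := s1.sub s2'
  have e3 := s3.hasSum.prod_fiberwise fun x => (s3.prod_factor x).hasSum
  have e4 := key.unique e3
  have : HasSum (fun p : V × V => w p.1 p.2 * a p.1 * h p.2 * Ψ p.1 -
      w p.1 p.2 * a p.1 * h p.2 * Ψ p.2) (Ψ o * h o / θ) := by
    rw [e4, s1.tsum_sub s2', ← e2]
    exact s1.hasSum.sub s2.hasSum
  exact hasSum_of_eq this (fun p => by ring) rfl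

end IsDiscountedPair

theorem mul_mul_eq_mul_div {w a h : ℝ} (k : ℝ) (hh : h ≠ 0) :
    w * a * k = w * h * k * (a / h) := by
  field_simp

namespace IsDiscountedPair

variable {V : Type*} {w : V → V → ℝ} {W : V → ℝ} {z : Set V} {o : V} {θ : ℝ} {a h : V → ℝ}
  (P : IsDiscountedPair w W z o θ a h)

include P

/-- The flow of `w x y * (a x * h y - a y * h x)` into `z` equals its source at `o`. -/
theorem hasSum_into : HasSum ({p : V × V | p.1 ∉ z ∧ p.2 ∈ z}.indicator
    fun p => w p.1 p.2 * a p.1) (h o / θ) := by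
  -- The indicator of the complement as test function has a nonzero increment only on edges between
  -- z and its complement.
  have hb : ∀ x, |zᶜ.indicator (fun _ => (1 : ℝ)) x| ≤ 1 := fun x => by
    by_cases hx : x ∈ z
    · rw [Set.indicator_of_notMem (not_not.2 hx)]
      simp
    · rw [Set.indicator_of_mem (show x ∈ zᶜ from hx)]
      simp
  have := P.hasSum_flow _ 1 hb fun x hx => Set.indicator_of_notMem (not_not.2 hx) _
  rw [Set.indicator_of_mem (show o ∈ zᶜ from P.pole), one_mul] at this
  refine hasSum_of_eq this (fun p => ?_) rfl
  by_cases h1 : p.1 ∈ z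
  · rw [Set.indicator_of_notMem (fun hp => hp.1 h1), P.a_of_mem _ h1]
    ring
  · rw [Set.indicator_of_mem (show p.1 ∈ zᶜ from h1)]
    by_cases h2 : p.2 ∈ z
    · rw [Set.indicator_of_mem (show p ∈ {p : V × V | p.1 ∉ z ∧ p.2 ∈ z} from ⟨h1, h2⟩),
        Set.indicator_of_notMem (s := zᶜ) (not_not.2 h2), P.h_of_mem _ h2]
      ring
    · rw [Set.indicator_of_notMem (fun hp => h2 hp.2),
        Set.indicator_of_mem (show p.2 ∈ zᶜ from h2)]
      ring

/-- Off z one has h ≤ θ, and by symmetry the edges into z carry at most the weight of z. This is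
where that weight enters. -/
theorem summable_boundary {wz : ℝ} (hwz : HasSum (z.indicator W) wz) :
    ∃ s ≤ θ * wz, HasSum ({p : V × V | p.1 ∉ z ∧ p.2 ∈ z}.indicator
      fun p => w p.1 p.2 * h p.1) s := by
  have hrow : ∀ y, HasSum (fun x => z.indicator (fun _ => w y x) y) (z.indicator W y) := fun y => by
    by_cases hy : y ∈ z
    · simp_rw [Set.indicator_of_mem hy]
      exact P.hasSum y
    · simp_rw [Set.indicator_of_notMem hy]
      exact hasSum_zero
  have hnn : ∀ p : V × V, 0 ≤ z.indicator (fun _ => w p.1 p.2) p.1 := fun p =>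
    Set.indicator_nonneg (fun _ _ => P.nonneg _ _) _
  have s0 : Summable fun p : V × V => z.indicator (fun _ => w p.1 p.2) p.1 :=
    (summable_prod_of_nonneg (f := fun p : V × V => z.indicator (fun _ => w p.1 p.2) p.1) hnn).2
      ⟨fun y => (hrow y).summable, hwz.summable.congr fun y => (hrow y).tsum_eq.symm⟩
  have h0 : HasSum (fun p : V × V => z.indicator (fun _ => w p.1 p.2) p.1) wz := by
    have e := s0.hasSum.prod_fiberwise fun y => hrow y
    rw [hwz.unique e]
    exact s0.hasSum
  have h1 : HasSum (fun p : V × V => θ * z.indicator (fun _ => w p.2 p.1) p.2) (θ * wz) :=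
    ((Equiv.prodComm V V).hasSum_iff.2 h0).mul_left θ
  have hle : ∀ p : V × V, {p : V × V | p.1 ∉ z ∧ p.2 ∈ z}.indicator
      (fun p => w p.1 p.2 * h p.1) p ≤ θ * z.indicator (fun _ => w p.2 p.1) p.2 := fun p => by
    by_cases hp : p.1 ∉ z ∧ p.2 ∈ z
    · rw [Set.indicator_of_mem (show p ∈ {p : V × V | p.1 ∉ z ∧ p.2 ∈ z} from hp),
        Set.indicator_of_mem hp.2, P.symm p.2 p.1, mul_comm]
      exact mul_le_mul_of_nonneg_right (P.h_le _ hp.1) (P.nonneg _ _)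
    · rw [Set.indicator_of_notMem (show p ∉ {p : V × V | p.1 ∉ z ∧ p.2 ∈ z} from hp)]
      exact mul_nonneg P.discount_pos.le (hnn p.swap)
  have s1 : Summable ({p : V × V | p.1 ∉ z ∧ p.2 ∈ z}.indicator fun p => w p.1 p.2 * h p.1) :=
    h1.summable.of_nonneg_of_le (fun p => Set.indicator_nonneg
      (fun _ _ => mul_nonneg (P.nonneg _ _) (P.h_nonneg _)) _) hle
  exact ⟨_, hasSum_le hle s1.hasSum h1, s1.hasSum⟩

/-! ### The dual potential and the bound for the discounted mean -/

section pairs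

variable {α c M : ℝ} {κ : V → ℝ}

/-- The truncated potential `-α κ - c log (a / h)`, set to `0` on `z`. -/
noncomputable def potential (_ : IsDiscountedPair w W z o θ a h) (α c M : ℝ) (κ : V → ℝ) (x : V) :
    ℝ :=
  zᶜ.indicator (fun x => max (-M) (min (-α * κ x - c * Real.log (a x / h x)) M)) x

theorem potential_of_mem {x : V} (hx : x ∈ z) : P.potential α c M κ x = 0 :=
  Set.indicator_of_notMem (not_not.2 hx) _

theorem potential_of_notMem {x : V} (hx : x ∉ z) : P.potential α c M κ x =
    max (-M) (min (-α * κ x - c * Real.log (a x / h x)) M) :=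
  Set.indicator_of_mem (show x ∈ zᶜ from hx) _

theorem abs_potential_le (hM : 0 ≤ M) (x : V) : |P.potential α c M κ x| ≤ M := by
  by_cases hx : x ∈ z
  · rw [P.potential_of_mem hx, abs_zero]
    exact hM
  · rw [P.potential_of_notMem hx, abs_le]
    exact ⟨le_max_left _ _, max_le (by linarith) (min_le_right _ _)⟩

/-- By the minimum principle `a` and `h` vanish at both ends of an edge or at neither. Edges without
traffic are thus harmless, and on the others the logarithms make sense. -/
theorem flow_zero_or_pos {x y : V} (hx : x ∉ z) (hy : y ∉ z) :
    (w x y * a x * h y = 0 ∧ w y x * a y * h x = 0) ∨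
      (0 < w x y ∧ 0 < a x ∧ 0 < a y ∧ 0 < h x ∧ 0 < h y) := by
  by_cases hw : w x y = 0
  · left
    rw [P.symm y x, hw]
    simp
  have hw' : w y x ≠ 0 := by rwa [P.symm y x]
  by_cases hax : a x = 0
  · have hay : a y = 0 := by_contra fun h' => P.a_ne_zero hx hw h' hax
    left
    simp [hax, hay]
  by_cases hhx : h x = 0
  · have hhy : h y = 0 := by_contra fun h' => P.h_ne_zero hx hw h' hhx
    left
    simp [hhx, hhy]
  right
  exact ⟨(P.nonneg _ _).lt_of_ne' hw, (P.a_nonneg _).lt_of_ne' hax,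
    (P.a_nonneg _).lt_of_ne' (P.a_ne_zero hy hw' hax), (P.h_nonneg _).lt_of_ne' hhx,
    (P.h_nonneg _).lt_of_ne' (P.h_ne_zero hy hw' hhx)⟩

/-- Dual feasibility on an edge. Divided by w(x,y) h(x) h(y), the net flow is v - u and the traffic
v + u, where v and u are the ratios a/h; with ρ = v/u the potential increment is at most α - c log
ρ, apart from truncation. -/
theorem pair_nonneg_of_le (hα : 0 ≤ α)
    (hρ : ∀ ρ : ℝ, 1 < ρ → α - c * Real.log ρ ≤ (ρ + 1) / (ρ - 1)) {x y : V} (hx : x ∉ z)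
    (hy : y ∉ z) (hκ : κ y - κ x ≤ 1) (hw : 0 < w x y) (hax : 0 < a x) (hay : 0 < a y)
    (hhx : 0 < h x) (hhy : 0 < h y) (hv : a y / h y ≤ a x / h x) :
    (w x y * a x * h y - w y x * a y * h x) *
      (P.potential α c M κ x - P.potential α c M κ y) ≤ w x y * a x * h y + w y x * a y * h x := by
  rw [P.potential_of_notMem hx, P.potential_of_notMem hy]
  have hd := max_min_sub_le M (-α * κ x - c * Real.log (a x / h x))
    (-α * κ y - c * Real.log (a y / h y))
  set d := max (-M) (min (-α * κ x - c * Real.log (a x / h x)) M) -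
    max (-M) (min (-α * κ y - c * Real.log (a y / h y)) M)
  rw [mul_mul_eq_mul_div (h y) hhx.ne', mul_mul_eq_mul_div (h x) hhy.ne', P.symm y x]
  have hvx : 0 < a x / h x := by positivity
  have hvy : 0 < a y / h y := by positivity
  generalize a x / h x = v at *
  generalize a y / h y = u at *
  have hk : 0 < w x y * h x * h y := by positivity
  suffices hs : (v - u) * d ≤ v + u by
    have := mul_le_mul_of_nonneg_left hs hk.le
    linarith
  rcases hv.lt_or_eq with hlt | heq
  · have h1 : α - c * Real.log (v / u) ≤ (v / u + 1) / (v / u - 1) :=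
      hρ _ ((one_lt_div hvy).2 hlt)
    have e : (v / u + 1) / (v / u - 1) = (v + u) / (v - u) := by
      have : v - u ≠ 0 := by linarith
      have : v / u - 1 ≠ 0 := by
        rw [div_sub_one hvy.ne']
        positivity
      field_simp
    rw [e, Real.log_div hvx.ne' hvy.ne'] at h1
    have h2 : d ≤ (v + u) / (v - u) := by
      refine hd.trans (max_le (div_nonneg (by linarith) (by linarith)) ?_)
      nlinarith
    calc (v - u) * d ≤ (v - u) * ((v + u) / (v - u)) :=
          mul_le_mul_of_nonneg_left h2 (by linarith)
      _ = v + u := mul_div_cancel₀ _ (by linarith)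
  · rw [heq, sub_self, zero_mul]
    linarith

/-- Where κ does not change, the potential decreases in a/h, while the flow runs from large to small
a/h. The traffic of such an edge is therefore not used up at all. -/
theorem pair_flat_of_le (hc : 0 ≤ c) {x y : V} (hx : x ∉ z)
    (hy : y ∉ z) (hκ : κ y = κ x) (hw : 0 < w x y) (hay : 0 < a y)
    (hhx : 0 < h x) (hhy : 0 < h y) (hv : a y / h y ≤ a x / h x) :
    (w x y * a x * h y - w y x * a y * h x) *
      (P.potential α c M κ x - P.potential α c M κ y) ≤ 0 := by
  rw [P.potential_of_notMem hx, P.potential_of_notMem hy]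
  have hd := max_min_sub_le M (-α * κ x - c * Real.log (a x / h x))
    (-α * κ y - c * Real.log (a y / h y))
  set d := max (-M) (min (-α * κ x - c * Real.log (a x / h x)) M) -
    max (-M) (min (-α * κ y - c * Real.log (a y / h y)) M)
  rw [mul_mul_eq_mul_div (h y) hhx.ne', mul_mul_eq_mul_div (h x) hhy.ne', P.symm y x]
  have hvy : 0 < a y / h y := by positivity
  have hlog := Real.log_le_log hvy hv
  have h2 : d ≤ 0 := hd.trans (max_le le_rfl (by rw [hκ]; nlinarith))
  have hk : 0 < w x y * h x * h y := by positivity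
  have h3 : 0 ≤ w x y * h x * h y * (a x / h x) - w x y * h y * h x * (a y / h y) := by
    nlinarith
  nlinarith

theorem pair_nonneg (hα : 0 ≤ α)
    (hρ : ∀ ρ : ℝ, 1 < ρ → α - c * Real.log ρ ≤ (ρ + 1) / (ρ - 1))
    (hκ : ∀ x ∉ z, ∀ y ∉ z, w x y ≠ 0 → κ y - κ x ≤ 1) {x y : V} (hx : x ∉ z) (hy : y ∉ z) :
    (w x y * a x * h y - w y x * a y * h x) *
      (P.potential α c M κ x - P.potential α c M κ y) ≤ w x y * a x * h y + w y x * a y * h x := by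
  rcases P.flow_zero_or_pos hx hy with ⟨h1, h2⟩ | ⟨hw, hax, hay, hhx, hhy⟩
  · rw [h1, h2]
    simp
  have hw' : 0 < w y x := by rwa [P.symm y x]
  rcases le_total (a y / h y) (a x / h x) with hv | hv
  · exact P.pair_nonneg_of_le hα hρ hx hy (hκ x hx y hy hw.ne') hw hax hay hhx hhy hv
  · have := P.pair_nonneg_of_le (M := M) hα hρ hy hx (hκ y hy x hx hw'.ne') hw' hay hax hhy hhx hv
    linarith

theorem pair_flat (hc : 0 ≤ c) {x y : V} (hx : x ∉ z) (hy : y ∉ z)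
    (hκ : w x y ≠ 0 → κ y = κ x) :
    (w x y * a x * h y - w y x * a y * h x) *
      (P.potential α c M κ x - P.potential α c M κ y) ≤ 0 := by
  rcases P.flow_zero_or_pos hx hy with ⟨h1, h2⟩ | ⟨hw, hax, hay, hhx, hhy⟩
  · rw [h1, h2]
    simp
  have hw' : 0 < w y x := by rwa [P.symm y x]
  rcases le_total (a y / h y) (a x / h x) with hv | hv
  · exact P.pair_flat_of_le hc hx hy (hκ hw.ne') hw hay hhx hhy hv
  · have := P.pair_flat_of_le (M := M) (α := α) hc hy hx (hκ hw.ne').symm hw' hax hhy hhx hv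
    linarith

/-- On edges into `z` the potential is controlled by the tangent of the logarithm. -/
theorem potential_boundary (hc : 0 ≤ c) {n U k : ℝ} (hU : 0 < U) (ho : 0 < h o)
    (hk : k = -α * n - c * Real.log (a o / h o) + c * Real.log U - c) (hkM : -M ≤ k)
    {x y : V} (hx : x ∉ z) (hy : y ∈ z) (hκ : w x y ≠ 0 → κ x = n) :
    w x y * a x * P.potential α c M κ x ≤
      k * (w x y * a x) + c * (a o / h o) / U * (w x y * h x) := by
  have hao := P.a_pole_pos
  have hC : 0 ≤ c * (a o / h o) / U := by positivity
  have hrest : 0 ≤ c * (a o / h o) / U * (w x y * h x) :=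
    mul_nonneg hC (mul_nonneg (P.nonneg _ _) (P.h_nonneg _))
  by_cases hw : w x y = 0
  · simp [hw]
  by_cases hax : a x = 0
  · simpa [hax] using hrest
  have hw0 : 0 < w x y := (P.nonneg _ _).lt_of_ne' hw
  have hax0 : 0 < a x := (P.a_nonneg _).lt_of_ne' hax
  have hhx : 0 < h x := (P.h_nonneg _).lt_of_ne' (P.h_ne_zero hx hw (by simp [P.h_of_mem y hy]))
  rw [P.potential_of_notMem hx, hκ hw]
  have h1 : Real.log (a o / h o / (a x / h x) / U) ≤ a o / h o / (a x / h x) / U - 1 :=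
    Real.log_le_sub_one_of_pos (by positivity)
  rw [Real.log_div (by positivity) hU.ne', Real.log_div (by positivity) (by positivity)] at h1
  have h2 := mul_le_mul_of_nonneg_left h1 hc
  have hq : 0 ≤ c * (a o / h o / (a x / h x) / U) := by positivity
  have h3 : max (-M) (min (-α * n - c * Real.log (a x / h x)) M) ≤
      k + c * (a o / h o / (a x / h x) / U) :=
    max_le (by linarith) ((min_le_left _ _).trans (by rw [hk]; linarith))
  calc _ ≤ w x y * a x * (k + c * (a o / h o / (a x / h x) / U)) :=
        mul_le_mul_of_nonneg_left h3 (by positivity)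
    _ = _ := by field_simp

/-- The basic lower bound for the discounted mean of the hitting time: a linear programming
duality bound for the flow `w x y * (a x * h y - a y * h x)`. -/
theorem mean_ge {wz n U η : ℝ} (hwz : HasSum (z.indicator W) wz) (hα : 0 ≤ α) (hc : 0 ≤ c)
    (hρ : ∀ ρ : ℝ, 1 < ρ → α - c * Real.log ρ ≤ (ρ + 1) / (ρ - 1))
    (hκ : ∀ x ∉ z, ∀ y ∉ z, w x y ≠ 0 → κ y - κ x ≤ 1)
    (hκz : ∀ x ∉ z, ∀ y ∈ z, w x y ≠ 0 → κ x = n) (hoz : ∀ y ∈ z, w o y = 0)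
    (hη : η = 0 ∨ η = 1 ∧ ∀ y, w o y ≠ 0 → κ y = κ o) (ho : 0 < h o) (hU : 0 < U)
    (hUle : θ ^ 2 * wz * a o ≤ U * h o ^ 2) :
    h o * (1 + η * (W o * a o) + α * (n - κ o) - c * Real.log U) ≤ ∑' x, W x * a x * h x := by
  classical
  have hθ := P.discount_pos
  have hao := P.a_pole_pos
  -- The constant term of the tangent used on the edges into z. M is so large that truncation leaves
  -- the potential at the pole alone and that its lower cutoff stays below k.
  set k : ℝ := -α * n - c * Real.log (a o / h o) + c * Real.log U - c with hk
  set Φo : ℝ := -α * κ o - c * Real.log (a o / h o) with hΦo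
  set M : ℝ := |k| + |Φo| with hM
  have hM0 : 0 ≤ M := by positivity
  have hkM : -M ≤ k := by linarith [neg_abs_le k, abs_nonneg Φo]
  have hΨo : P.potential α c M κ o = Φo := by
    rw [P.potential_of_notMem P.pole, ← hΦo, min_eq_left (by linarith [le_abs_self Φo, abs_nonneg k]),
      max_eq_right (by linarith [neg_abs_le Φo, abs_nonneg k])]
  obtain ⟨b, hb, hB⟩ := P.summable_boundary hwz
  have hN := P.hasSum_prod.sub (P.hasSum_flow (P.potential α c M κ) M (P.abs_potential_le hM0)
    fun x hx => P.potential_of_mem hx)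
  have hrow : HasSum (fun p : V × V => if p.1 = o then w p.1 p.2 * a p.1 * h p.2 else 0)
      (W o * a o * h o / θ) := by
    have hinj : Function.Injective fun y : V => (o, y) := fun y y' e => (Prod.ext_iff.1 e).2
    refine (hinj.hasSum_iff (fun p hp => if_neg fun e => hp ⟨p.2, by rw [← e]⟩)).1 ?_
    exact hasSum_of_eq (P.hasSum_row o) (fun y => by simp) rfl
  -- The minorant of traffic minus flow times potential increment: it lives on the edges into z and,
  -- for η = 1, also on the steps that leave the pole.
  have hBt := (hrow.mul_left η).add ((P.hasSum_into.mul_left (1 - k)).sub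
    (hB.mul_left (c * (a o / h o) / U)))
  have hcase : ∀ x ∉ z, ∀ y ∈ z, η * (if x = o then w x y * a x * h y else 0) +
      ((1 - k) * (w x y * a x) - c * (a o / h o) / U * (w x y * h x)) ≤
      w x y * a x * h y - w x y * a x * h y * (P.potential α c M κ x - P.potential α c M κ y) := by
    intro x hx y hy
    have h0 : (if x = o then w x y * a x * h y else 0) = 0 := by
      split_ifs with e
      · rw [e, hoz y hy]
        simp
      · rfl
    have := P.potential_boundary (M := M) hc hU ho hk hkM hx hy (hκz x hx y hy)
    rw [h0, P.potential_of_mem hy, P.h_of_mem y hy]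
    linarith
  have hle := hN.le_of_add_swap_le hBt fun p => ?_
  · rw [hΨo] at hle
    -- The hypothesis on U says just that the linear part of the tangent is paid for by the -c
    -- contained in k.
    have h1 : c * (a o / h o) / U * b ≤ c * (h o / θ) := by
      have h2 : a o / h o / U * (θ * wz) ≤ h o / θ := by
        rw [div_div, div_mul_eq_mul_div, div_le_div_iff₀ (by positivity) hθ]
        nlinarith
      calc c * (a o / h o) / U * b ≤ c * (a o / h o) / U * (θ * wz) :=
            mul_le_mul_of_nonneg_left hb (by positivity)
        _ = c * (a o / h o / U * (θ * wz)) := by ring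
        _ ≤ _ := mul_le_mul_of_nonneg_left h2 hc
    have h3 : η * (W o * a o * h o / θ) + (1 - k) * (h o / θ) - c * (h o / θ) + Φo * h o / θ ≤
        (∑' x, W x * a x * h x) / θ := by linarith
    have h4 := mul_le_mul_of_nonneg_right h3 hθ.le
    rw [div_mul_cancel₀ _ hθ.ne'] at h4
    refine le_trans (le_of_eq ?_) h4
    rw [hk, hΦo]
    field_simp
    ring
  · obtain ⟨x, y⟩ := p
    simp only [Prod.swap_prod_mk]
    have hind : ∀ (F : V × V → ℝ) (x y : V), x ∉ z → y ∈ z →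
        {p : V × V | p.1 ∉ z ∧ p.2 ∈ z}.indicator F (x, y) = F (x, y) :=
      fun F x y hx hy => Set.indicator_of_mem (show (x, y) ∈ {p : V × V | p.1 ∉ z ∧ p.2 ∈ z} from
        ⟨hx, hy⟩) F
    have hind0 : ∀ (F : V × V → ℝ) (x y : V), ¬(x ∉ z ∧ y ∈ z) →
        {p : V × V | p.1 ∉ z ∧ p.2 ∈ z}.indicator F (x, y) = 0 :=
      fun F x y hxy => Set.indicator_of_notMem
        (show (x, y) ∉ {p : V × V | p.1 ∉ z ∧ p.2 ∈ z} from hxy) F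
    by_cases hx : x ∈ z <;> by_cases hy : y ∈ z
    · rw [hind0 _ x y (by tauto), hind0 _ y x (by tauto), hind0 _ x y (by tauto),
        hind0 _ y x (by tauto), P.a_of_mem x hx, P.a_of_mem y hy]
      simp
    · have := hcase y hy x hx
      rw [hind0 _ x y (by tauto), hind _ y x hy hx, hind0 _ x y (by tauto), hind _ y x hy hx,
        P.a_of_mem x hx]
      simp only [mul_zero, zero_mul, ite_self, sub_zero, zero_add, add_zero]
      exact this
    · have := hcase x hx y hy
      rw [hind0 _ y x (by tauto), hind _ x y hx hy, hind0 _ y x (by tauto), hind _ x y hx hy,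
        P.a_of_mem y hy]
      simp only [mul_zero, zero_mul, ite_self, sub_zero, add_zero]
      exact this
    · rw [hind0 _ x y (by tauto), hind0 _ y x (by tauto), hind0 _ x y (by tauto),
        hind0 _ y x (by tauto)]
      have g0 := P.pair_nonneg (M := M) hα hρ hκ hx hy
      have n1 : 0 ≤ w x y * a x * h y :=
        mul_nonneg (mul_nonneg (P.nonneg _ _) (P.a_nonneg _)) (P.h_nonneg _)
      have n2 : 0 ≤ w y x * a y * h x :=
        mul_nonneg (mul_nonneg (P.nonneg _ _) (P.a_nonneg _)) (P.h_nonneg _)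
      rcases hη with rfl | ⟨rfl, hflat⟩
      · linarith
      · by_cases hxo : x = o
        · have g1 := P.pair_flat (M := M) (α := α) hc hx hy
            (fun hw => by rw [hxo]; exact hflat y (hxo ▸ hw))
          split_ifs <;> linarith
        · by_cases hyo : y = o
          · have g1 := P.pair_flat (M := M) (α := α) hc hx hy
              (fun hw => by rw [hyo]; exact (hflat x (by rw [P.symm]; exact hyo ▸ hw)).symm)
            rw [if_neg hxo]
            split_ifs
            linarith
          · rw [if_neg hxo, if_neg hyo]
            linarith

end pairs

end IsDiscountedPair

/-! ### Reversibility and occupation times -/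

/-- There are t ways to write t = s + r + 1. Here s is the time of a visit before the hitting time
t. -/
theorem tsum_tsum_add_succ (c : ℕ → ℝ≥0∞) : ∑' s : ℕ, ∑' r : ℕ, c (s + r + 1) = ∑' t : ℕ, t * c t := by
  rw [← ENNReal.tsum_prod (f := fun s r => c (s + r + 1)),
    ← Finset.HasAntidiagonal.sigmaAntidiagonalEquivProd.tsum_eq, ENNReal.tsum_sigma',
    tsum_eq_zero_add' (f := fun t : ℕ => (t : ℝ≥0∞) * c t) ENNReal.summable]
  simp only [Nat.cast_zero, zero_mul, zero_add]
  refine tsum_congr fun n => ?_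
  have : ∀ p : Finset.HasAntidiagonal.antidiagonal n, c ((Finset.HasAntidiagonal.sigmaAntidiagonalEquivProd ⟨n, p⟩ : ℕ × ℕ).1 +
      (Finset.HasAntidiagonal.sigmaAntidiagonalEquivProd ⟨n, p⟩ : ℕ × ℕ).2 + 1) = c (n + 1) := fun p => by
    rw [Finset.HasAntidiagonal.sigmaAntidiagonalEquivProd_apply,
      Finset.HasAntidiagonal.mem_antidiagonal.1 p.2]
  rw [tsum_congr this, tsum_fintype]
  simp

theorem indicator_singleton_eq_zero {V : Type*} {z : Set V} {o x : V} (ho : o ∉ z) (hx : x ∈ z) :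
    ({o} : Set V).indicator (1 : V → ℝ≥0∞) x = 0 :=
  Set.indicator_of_notMem (show x ∉ ({o} : Set V) from fun e =>
    ho ((show x = o from e) ▸ hx)) _

namespace WeightedGraph

variable {V : Type*} (G : WeightedGraph V) (o : V) (z : Set V)

theorem vertexWeight_ne_top (x : V) : G.vertexWeight x ≠ ⊤ := G.finite_weight x

theorem vertexWeight_mul_step (x y : V) : G.vertexWeight x * G.step x y = G.w x y := by
  by_cases h : (∑' y, (G.w x y : ℝ≥0∞)) = 0
  · rw [vertexWeight, h, zero_mul, ENNReal.tsum_eq_zero.1 h y]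
  · rw [vertexWeight, step, dif_neg h, PMF.normalize_apply, mul_comm, mul_assoc,
      ENNReal.inv_mul_cancel h (G.finite_weight x), mul_one]

theorem vertexWeight_mul_killedStep {x : V} (hx : x ∉ z) (φ : V → ℝ≥0∞) :
    G.vertexWeight x * killedStep G.step z φ x = ∑' y, (G.w x y : ℝ≥0∞) * φ y := by
  rw [killedStep_of_notMem _ _ hx, ← ENNReal.tsum_mul_left]
  exact tsum_congr fun y => by rw [← mul_assoc, vertexWeight_mul_step]

/-- The killed walk is reversible. -/
theorem tsum_killedStep_comm {φ ψ : V → ℝ≥0∞} (hφ : ∀ x ∈ z, φ x = 0) (hψ : ∀ x ∈ z, ψ x = 0) :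
    ∑' x, G.vertexWeight x * killedStep G.step z φ x * ψ x =
      ∑' x, G.vertexWeight x * φ x * killedStep G.step z ψ x := by
  have h1 : ∀ φ ψ : V → ℝ≥0∞, (∀ x ∈ z, ψ x = 0) → ∀ x,
      G.vertexWeight x * killedStep G.step z φ x * ψ x =
        ∑' y, (G.w x y : ℝ≥0∞) * φ y * ψ x := fun φ ψ hψ x => by
    by_cases hx : x ∈ z
    · simp [hψ x hx]
    · rw [G.vertexWeight_mul_killedStep z hx, ENNReal.tsum_mul_right]
  have h2 : ∀ x, G.vertexWeight x * φ x * killedStep G.step z ψ x =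
      G.vertexWeight x * killedStep G.step z ψ x * φ x := fun x => by ring
  rw [tsum_congr (h1 φ ψ hψ), tsum_congr h2, tsum_congr (h1 ψ φ hφ), ENNReal.tsum_comm]
  refine tsum_congr fun x => tsum_congr fun y => ?_
  rw [G.symm y x]
  ring

theorem iterate_killedStep_of_mem {φ : V → ℝ≥0∞} (hφ : ∀ x ∈ z, φ x = 0) (t : ℕ) :
    ∀ x ∈ z, (killedStep G.step z)^[t] φ x = 0 := by
  intro x hx
  cases t with
  | zero => exact hφ x hx
  | succ t =>
    rw [Function.iterate_succ_apply']
    exact killedStep_of_mem _ _ hx _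

theorem tsum_iterate_killedStep_comm {φ ψ : V → ℝ≥0∞} (hφ : ∀ x ∈ z, φ x = 0)
    (hψ : ∀ x ∈ z, ψ x = 0) (t : ℕ) :
    ∑' x, G.vertexWeight x * (killedStep G.step z)^[t] φ x * ψ x =
      ∑' x, G.vertexWeight x * φ x * (killedStep G.step z)^[t] ψ x := by
  induction t generalizing ψ with
  | zero => rfl
  | succ t ih =>
    rw [Function.iterate_succ_apply', G.tsum_killedStep_comm z (G.iterate_killedStep_of_mem z hφ t) hψ,
      ih fun x hx => killedStep_of_mem _ _ hx _, Function.iterate_succ_apply]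

/-- Reversibility: the walk from `o` tested against `ψ`. -/
theorem tsum_iterate_killedStep_single (ho : o ∉ z) {ψ : V → ℝ≥0∞} (hψ : ∀ x ∈ z, ψ x = 0)
    (t : ℕ) :
    ∑' x, G.vertexWeight x * (killedStep G.step z)^[t] (({o} : Set V).indicator 1) x * ψ x =
      G.vertexWeight o * (killedStep G.step z)^[t] ψ o := by
  rw [G.tsum_iterate_killedStep_comm z (fun x hx => indicator_singleton_eq_zero ho hx) hψ,
    tsum_eq_single o]
  · rw [Set.indicator_of_mem (Set.mem_singleton o), Pi.one_apply, mul_one]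
  · intro x hx
    rw [Set.indicator_of_notMem (fun e => hx (Set.mem_singleton_iff.1 e)), mul_zero, zero_mul]

/-- The discounted number of visits to `o` before `z`. -/
noncomputable def visitSeries (θ : ℝ≥0∞) (x : V) : ℝ≥0∞ :=
  ∑' t : ℕ, θ ^ t * (killedStep G.step z)^[t] (({o} : Set V).indicator 1) x

variable {o z}

theorem visitSeries_eq (θ : ℝ≥0∞) (x : V) : G.visitSeries o z θ x =
    ({o} : Set V).indicator 1 x + θ * killedStep G.step z (G.visitSeries o z θ) x :=
  tsum_pow_mul_iterate_killedStep _ _ _ _ _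

theorem visitSeries_le (θ : ℝ≥0∞) (x : V) : G.visitSeries o z θ x ≤ (1 - θ)⁻¹ := by
  rw [← ENNReal.tsum_geometric]
  refine ENNReal.tsum_le_tsum fun t => mul_le_of_le_one_right' ?_
  exact iterate_killedStep_le_one _ _ (fun x => Set.indicator_le_self' (by simp) x) t x

theorem visitSeries_of_mem (ho : o ∉ z) (θ : ℝ≥0∞) {x : V} (hx : x ∈ z) :
    G.visitSeries o z θ x = 0 := by
  rw [visitSeries_eq, killedStep_of_mem _ _ hx, indicator_singleton_eq_zero ho hx, mul_zero, add_zero]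

theorem tsum_vertexWeight_mul_visitSeries_mul (ho : o ∉ z) (θ : ℝ≥0∞) {ψ : V → ℝ≥0∞}
    (hψ : ∀ x ∈ z, ψ x = 0) :
    ∑' x, G.vertexWeight x * G.visitSeries o z θ x * ψ x =
      G.vertexWeight o * ∑' t : ℕ, θ ^ t * (killedStep G.step z)^[t] ψ o := by
  simp_rw [visitSeries, ← ENNReal.tsum_mul_left, ← ENNReal.tsum_mul_right]
  rw [ENNReal.tsum_comm]
  refine tsum_congr fun t => ?_
  calc _ = θ ^ t * ∑' x, G.vertexWeight x *
        (killedStep G.step z)^[t] (({o} : Set V).indicator 1) x * ψ x := by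
        rw [← ENNReal.tsum_mul_left]
        exact tsum_congr fun x => by ring
    _ = _ := by
        rw [G.tsum_iterate_killedStep_single o z ho hψ]
        ring

theorem tsum_vertexWeight_mul_visitSeries_le (ho : o ∉ z) (θ : ℝ≥0∞) :
    ∑' x, G.vertexWeight x * G.visitSeries o z θ x ≤ G.vertexWeight o * (1 - θ)⁻¹ := by
  have h := G.tsum_vertexWeight_mul_visitSeries_mul ho θ (ψ := zᶜ.indicator 1)
    fun x hx => Set.indicator_of_notMem (not_not.2 hx) _
  have e : ∀ x, G.vertexWeight x * G.visitSeries o z θ x * zᶜ.indicator 1 x =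
      G.vertexWeight x * G.visitSeries o z θ x := fun x => by
    by_cases hx : x ∈ z
    · rw [G.visitSeries_of_mem ho θ hx]
      simp
    · rw [Set.indicator_of_mem (show x ∈ zᶜ from hx), Pi.one_apply, mul_one]
  rw [tsum_congr e] at h
  rw [h, ← ENNReal.tsum_geometric]
  gcongr with t
  refine mul_le_of_le_one_right' ?_
  exact iterate_killedStep_le_one _ _ (fun x => Set.indicator_le_self' (by simp) x) t o

/-- The derivative of the generating function of the hitting time, in terms of visits. -/
theorem tsum_visitSeries_mul_hitSeries (ho : o ∉ z) (θ : ℝ≥0∞) :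
    ∑' x, G.vertexWeight x * G.visitSeries o z θ x * hitSeries G.step z θ x =
      G.vertexWeight o * ∑' t : ℕ, t * (θ ^ t * (killedStep G.step z)^[t] (z.indicator 1) o) := by
  -- Agrees with the hitting function off z and vanishes on z, as reversibility of the killed walk
  -- requires.
  set ψ : V → ℝ≥0∞ := fun x => θ * killedStep G.step z (hitSeries G.step z θ) x with hψdef
  have hψ : ∀ x ∈ z, ψ x = 0 := fun x hx => by
    rw [hψdef]
    simp [killedStep_of_mem _ _ hx]
  have e : ∀ x, G.vertexWeight x * G.visitSeries o z θ x * hitSeries G.step z θ x =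
      G.vertexWeight x * G.visitSeries o z θ x * ψ x := fun x => by
    by_cases hx : x ∈ z
    · rw [G.visitSeries_of_mem ho θ hx]
      simp
    · rw [hitSeries_eq, Set.indicator_of_notMem hx, zero_add]
  have hψ' : ψ = fun x => ∑' r : ℕ, θ ^ (r + 1) *
      (killedStep G.step z)^[r + 1] (z.indicator 1) x := by
    funext x
    simp only [hψdef]
    unfold hitSeries
    rw [killedStep_tsum, ← ENNReal.tsum_mul_left]
    refine tsum_congr fun t => ?_
    rw [killedStep_const_mul, ← mul_assoc, ← pow_succ', Function.iterate_succ_apply']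
  have hit : ∀ (s : ℕ) (x : V), (killedStep G.step z)^[s] ψ x = ∑' r : ℕ, θ ^ (r + 1) *
      (killedStep G.step z)^[s + r + 1] (z.indicator 1) x := by
    intro s
    induction s with
    | zero =>
      intro x
      simp [hψ']
    | succ s ih =>
      intro x
      rw [Function.iterate_succ_apply', funext ih, killedStep_tsum]
      refine tsum_congr fun r => ?_
      rw [killedStep_const_mul, ← Function.iterate_succ_apply' (killedStep G.step z),
        show s + 1 + r + 1 = s + r + 1 + 1 by ring]
  rw [tsum_congr e, G.tsum_vertexWeight_mul_visitSeries_mul ho θ hψ, ← tsum_tsum_add_succ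
    (fun t => θ ^ t * (killedStep G.step z)^[t] (z.indicator 1) o)]
  congr 1
  refine tsum_congr fun s => ?_
  rw [hit, ← ENNReal.tsum_mul_left]
  refine tsum_congr fun r => ?_
  ring

end WeightedGraph

/-! ### The walk on the graph as a discounted pair of real functions -/

theorem hasSum_toReal_of_tsum_eq {ι : Type*} {f : ι → ℝ≥0∞} {s : ℝ≥0∞} (h : ∑' i, f i = s)
    (hs : s ≠ ⊤) : HasSum (fun i => (f i).toReal) s.toReal := by
  have h1 := ENNReal.hasSum_toReal (f := f) (h ▸ hs)
  rwa [← ENNReal.tsum_toReal_eq (ENNReal.ne_top_of_tsum_ne_top (h ▸ hs)), h] at h1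

namespace WeightedGraph

variable {V : Type*} (G : WeightedGraph V) {o : V} {z : Set V}

theorem hitSeries_ne_top {θ : ℝ} (hθ : θ < 1) (x : V) :
    hitSeries G.step z (ENNReal.ofReal θ) x ≠ ⊤ :=
  ne_top_of_le_ne_top ENNReal.one_ne_top (hitSeries_le_one _ _ (by simpa using hθ.le) x)

/-- Dividing the visits by the weight of o normalizes the source at o to 1. Discounting with θ < 1
makes all sums finite, even for an infinite graph on which z is never hit. -/
theorem isDiscountedPair (ho : o ∉ z) (hW : G.vertexWeight o ≠ 0) {θ : ℝ} (hθ0 : 0 < θ)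
    (hθ1 : θ < 1) : IsDiscountedPair (fun x y => (G.w x y : ℝ))
      (fun x => (G.vertexWeight x).toReal) z o θ
      (fun x => (G.visitSeries o z (ENNReal.ofReal θ) x).toReal / (G.vertexWeight o).toReal)
      (fun x => (hitSeries G.step z (ENNReal.ofReal θ) x).toReal) := by
  have hWo : 0 < (G.vertexWeight o).toReal := ENNReal.toReal_pos hW (G.vertexWeight_ne_top o)
  have hθe : ENNReal.ofReal θ ≠ 0 := by simpa using hθ0
  have hθle : ENNReal.ofReal θ ≤ 1 := by simpa using hθ1.le
  have hfin : ∀ {F : V → ℝ≥0∞} {b : ℝ≥0∞}, (∀ y, F y ≤ b) → b ≠ ⊤ → ∀ x,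
      ∑' y, (G.w x y : ℝ≥0∞) * F y ≠ ⊤ := fun {F b} hF hb x => by
    refine ne_top_of_le_ne_top (ENNReal.mul_ne_top (G.vertexWeight_ne_top x) hb) ?_
    rw [vertexWeight, ← ENNReal.tsum_mul_right]
    exact ENNReal.tsum_le_tsum fun y => mul_le_mul_right (hF y) _
  have hAfin : ∀ x, ∑' y, (G.w x y : ℝ≥0∞) * G.visitSeries o z (ENNReal.ofReal θ) y ≠ ⊤ :=
    hfin (G.visitSeries_le _) (ENNReal.inv_ne_top.2 (tsub_pos_of_lt (by simpa using hθ1)).ne')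
  have hHfin : ∀ x, ∑' y, (G.w x y : ℝ≥0∞) * hitSeries G.step z (ENNReal.ofReal θ) y ≠ ⊤ :=
    hfin (hitSeries_le_one _ _ hθle) ENNReal.one_ne_top
  have hAsum : ∀ x, HasSum (fun y => (G.w x y : ℝ) *
      ((G.visitSeries o z (ENNReal.ofReal θ) y).toReal / (G.vertexWeight o).toReal))
      ((∑' y, (G.w x y : ℝ≥0∞) * G.visitSeries o z (ENNReal.ofReal θ) y).toReal /
        (G.vertexWeight o).toReal) := fun x =>
    hasSum_of_eq ((hasSum_toReal_of_tsum_eq rfl (hAfin x)).div_const (G.vertexWeight o).toReal)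
      (fun y => by rw [ENNReal.toReal_mul, ENNReal.coe_toReal, mul_div_assoc]) rfl
  have hAeq : ∀ x ∉ z, (G.vertexWeight x).toReal *
      (G.visitSeries o z (ENNReal.ofReal θ) x).toReal =
        (G.vertexWeight x).toReal * (({o} : Set V).indicator (1 : V → ℝ≥0∞) x).toReal +
        θ * (∑' y, (G.w x y : ℝ≥0∞) * G.visitSeries o z (ENNReal.ofReal θ) y).toReal :=
    fun x hx => by
    have h := congrArg (fun q => (G.vertexWeight x * q).toReal)
      (G.visitSeries_eq (o := o) (z := z) (ENNReal.ofReal θ) x)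
    have hi : ({o} : Set V).indicator (1 : V → ℝ≥0∞) x ≠ ⊤ :=
      ne_top_of_le_ne_top ENNReal.one_ne_top (Set.indicator_le_self' (by simp) x)
    rw [mul_add, mul_left_comm, G.vertexWeight_mul_killedStep z hx, ENNReal.toReal_add
      (ENNReal.mul_ne_top (G.vertexWeight_ne_top x) hi)
      (ENNReal.mul_ne_top ENNReal.ofReal_ne_top (hAfin x)), ENNReal.toReal_mul, ENNReal.toReal_mul,
      ENNReal.toReal_mul, ENNReal.toReal_ofReal hθ0.le] at h
    exact h
  exact
  { nonneg := fun x y => NNReal.coe_nonneg _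
    symm := fun x y => by rw [G.symm x y]
    hasSum := fun x => hasSum_of_eq (hasSum_toReal_of_tsum_eq rfl (G.vertexWeight_ne_top x))
      (fun y => (ENNReal.coe_toReal _).symm) rfl
    pole := ho
    discount_pos := hθ0
    a_nonneg := fun x => by positivity
    h_nonneg := fun x => ENNReal.toReal_nonneg
    h_le_one := fun x => ENNReal.toReal_le_of_le_ofReal zero_le_one
      (by simpa using hitSeries_le_one _ _ hθle x)
    a_of_mem := fun x hx => by
      rw [G.visitSeries_of_mem ho _ hx]
      simp
    h_of_mem := fun x hx => by
      rw [hitSeries_of_mem _ _ _ hx]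
      simp
    h_le := fun x hx => by
      refine ENNReal.toReal_le_of_le_ofReal hθ0.le ?_
      rw [hitSeries_eq, Set.indicator_of_notMem hx, zero_add]
      exact mul_le_of_le_one_right' (killedStep_le_const _ _ (hitSeries_le_one _ _ hθle) x)
    h_step := fun x hx => by
      have h := congrArg (fun q => (G.vertexWeight x * q).toReal)
        (hitSeries_eq G.step z (ENNReal.ofReal θ) x)
      rw [Set.indicator_of_notMem hx, zero_add, mul_left_comm, G.vertexWeight_mul_killedStep z hx,
        ENNReal.toReal_mul, ENNReal.toReal_mul, ENNReal.toReal_ofReal hθ0.le] at h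
      refine hasSum_of_eq (hasSum_toReal_of_tsum_eq rfl (hHfin x)) (fun y => ?_) ?_
      · rw [ENNReal.toReal_mul, ENNReal.coe_toReal]
      · rw [h, mul_div_cancel_left₀ _ hθ0.ne']
    a_step := fun x hx hxo => by
      refine hasSum_of_eq (hAsum x) (fun y => rfl) ?_
      have h := hAeq x hx
      rw [Set.indicator_of_notMem (show x ∉ ({o} : Set V) from hxo), ENNReal.toReal_zero, mul_zero,
        zero_add] at h
      rw [← mul_div_assoc, h]
      field_simp
    a_step_pole := by
      refine hasSum_of_eq (hAsum o) (fun y => rfl) ?_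
      have h := hAeq o ho
      rw [Set.indicator_of_mem (Set.mem_singleton o), Pi.one_apply, ENNReal.toReal_one,
        mul_one] at h
      rw [← mul_div_assoc, h]
      field_simp
      ring
    summable := by
      have h : ∑' x, G.vertexWeight x * G.visitSeries o z (ENNReal.ofReal θ) x ≠ ⊤ :=
        ne_top_of_le_ne_top (ENNReal.mul_ne_top (G.vertexWeight_ne_top o)
          (ENNReal.inv_ne_top.2 (tsub_pos_of_lt (by simpa using hθ1)).ne'))
          (G.tsum_vertexWeight_mul_visitSeries_le ho _)
      refine ((hasSum_toReal_of_tsum_eq rfl h).div_const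
        (G.vertexWeight o).toReal).summable.congr fun x => ?_
      rw [ENNReal.toReal_mul, mul_div_assoc] }

/-- The probability that the walk from `o` hits `z` at time `t`. -/
noncomputable def hitProb (o : V) (z : Set V) (t : ℕ) : ℝ :=
  ((killedStep G.step z)^[t] (z.indicator 1) o).toReal

theorem iterate_killedStep_indicator_le_one (t : ℕ) (x : V) :
    (killedStep G.step z)^[t] (z.indicator 1) x ≤ 1 :=
  iterate_killedStep_le_one _ _ (fun x => Set.indicator_le_self' (by simp) x) t x

theorem hitProb_nonneg (t : ℕ) : 0 ≤ G.hitProb o z t := ENNReal.toReal_nonneg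

theorem hitProb_le_one (t : ℕ) : G.hitProb o z t ≤ 1 :=
  ENNReal.toReal_le_of_le_ofReal zero_le_one
    (by simpa using G.iterate_killedStep_indicator_le_one t o)

theorem toReal_hitSeries {θ : ℝ} (hθ0 : 0 < θ) (hθ1 : θ < 1) :
    (hitSeries G.step z (ENNReal.ofReal θ) o).toReal = ∑' t : ℕ, θ ^ t * G.hitProb o z t := by
  have h := hasSum_toReal_of_tsum_eq (f := fun t : ℕ => ENNReal.ofReal θ ^ t *
    (killedStep G.step z)^[t] (z.indicator 1) o) rfl (G.hitSeries_ne_top (z := z) hθ1 o)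
  refine h.tsum_eq.symm.trans (tsum_congr fun t => ?_)
  rw [ENNReal.toReal_mul, ENNReal.toReal_pow, ENNReal.toReal_ofReal hθ0.le, hitProb]

theorem tsum_visits_mul_hit (ho : o ∉ z) (hW : G.vertexWeight o ≠ 0) {θ : ℝ} (hθ0 : 0 < θ)
    (hθ1 : θ < 1) :
    ∑' x, (G.vertexWeight x).toReal *
      ((G.visitSeries o z (ENNReal.ofReal θ) x).toReal / (G.vertexWeight o).toReal) *
        (hitSeries G.step z (ENNReal.ofReal θ) x).toReal =
      ∑' t : ℕ, (t : ℝ) * (θ ^ t * G.hitProb o z t) := by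
  have hWo : 0 < (G.vertexWeight o).toReal := ENNReal.toReal_pos hW (G.vertexWeight_ne_top o)
  have key := G.tsum_visitSeries_mul_hitSeries ho (ENNReal.ofReal θ)
  have hfin : ∑' x, G.vertexWeight x * G.visitSeries o z (ENNReal.ofReal θ) x *
      hitSeries G.step z (ENNReal.ofReal θ) x ≠ ⊤ := by
    refine ne_top_of_le_ne_top (ENNReal.mul_ne_top (G.vertexWeight_ne_top o)
      (ENNReal.inv_ne_top.2 (tsub_pos_of_lt (?_ : ENNReal.ofReal θ < 1)).ne'))
      (le_trans (ENNReal.tsum_le_tsum fun x => ?_) (G.tsum_vertexWeight_mul_visitSeries_le ho _))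
    · simpa using hθ1
    · exact mul_le_of_le_one_right' (hitSeries_le_one _ _ (by simpa using hθ1.le) x)
  have h1 := hasSum_toReal_of_tsum_eq rfl hfin
  have hfin2 : ∑' t : ℕ, (t : ℝ≥0∞) * (ENNReal.ofReal θ ^ t *
      (killedStep G.step z)^[t] (z.indicator 1) o) ≠ ⊤ := fun htop => by
    rw [key, htop, ENNReal.mul_top hW] at hfin
    exact hfin rfl
  have h2 := hasSum_toReal_of_tsum_eq rfl hfin2
  have e1 : ∑' x, (G.vertexWeight x).toReal *
      ((G.visitSeries o z (ENNReal.ofReal θ) x).toReal / (G.vertexWeight o).toReal) *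
        (hitSeries G.step z (ENNReal.ofReal θ) x).toReal =
      (∑' x, G.vertexWeight x * G.visitSeries o z (ENNReal.ofReal θ) x *
        hitSeries G.step z (ENNReal.ofReal θ) x).toReal / (G.vertexWeight o).toReal := by
    rw [← (h1.div_const (G.vertexWeight o).toReal).tsum_eq]
    refine tsum_congr fun x => ?_
    rw [ENNReal.toReal_mul, ENNReal.toReal_mul]
    ring
  rw [e1, key, ENNReal.toReal_mul, mul_div_cancel_left₀ _ hWo.ne', ← h2.tsum_eq]
  refine tsum_congr fun t => ?_
  rw [ENNReal.toReal_mul, ENNReal.toReal_mul, ENNReal.toReal_pow, ENNReal.toReal_ofReal hθ0.le,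
    hitProb, ENNReal.toReal_natCast]

theorem hasSum_indicator_vertexWeight (hz : G.setWeight z ≠ ⊤) :
    HasSum (z.indicator fun x => (G.vertexWeight x).toReal) (G.setWeight z).toReal := by
  have h : ∑' x, z.indicator G.vertexWeight x = G.setWeight z := (tsum_subtype z _).symm
  refine hasSum_of_eq (hasSum_toReal_of_tsum_eq h hz) (fun x => ?_) rfl
  by_cases hx : x ∈ z
  · rw [Set.indicator_of_mem hx, Set.indicator_of_mem hx]
  · rw [Set.indicator_of_notMem hx, Set.indicator_of_notMem hx, ENNReal.toReal_zero]

end WeightedGraph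

/-! ### The differential inequality for the generating function -/

section generatingFunction

variable {p : ℕ → ℝ}

theorem hasDerivAt_tsum_pow_mul (hp0 : ∀ t, 0 ≤ p t) (hp1 : ∀ t, p t ≤ 1) {θ : ℝ} (hθ0 : 0 < θ)
    (hθ1 : θ < 1) : HasDerivAt (fun x : ℝ => ∑' t : ℕ, x ^ t * p t)
      ((∑' t : ℕ, (t : ℝ) * (θ ^ t * p t)) / θ) θ := by
  obtain ⟨ρ, hρ, hρ1⟩ := exists_between hθ1
  have hρ0 : 0 < ρ := hθ0.trans hρ
  have hu : Summable fun t : ℕ => (t : ℝ) * ρ ^ (t - 1) := by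
    have := (summable_pow_mul_geometric_of_norm_lt_one (r := ρ) 1
      (by rwa [Real.norm_of_nonneg hρ0.le])).div_const ρ
    refine this.congr fun t => ?_
    cases t with
    | zero => simp
    | succ t =>
      rw [pow_one, Nat.add_sub_cancel, pow_succ]
      field_simp
  have hmem : θ ∈ Set.Ioo 0 ρ := ⟨hθ0, hρ⟩
  have h := hasDerivAt_tsum_of_isPreconnected (g := fun (t : ℕ) (x : ℝ) => x ^ t * p t)
    (g' := fun t x => (t : ℝ) * x ^ (t - 1) * p t) (t := Set.Ioo 0 ρ) hu isOpen_Ioo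
    isPreconnected_Ioo (fun t x _ => (hasDerivAt_pow t x).mul_const (p t)) (fun t x hx => ?_) hmem
    ?_ hmem
  · refine h.congr_deriv ?_
    rw [← tsum_div_const]
    refine tsum_congr fun t => ?_
    cases t with
    | zero => simp
    | succ t =>
      rw [Nat.add_sub_cancel, pow_succ]
      field_simp
  · have hx0 : 0 < x := hx.1
    rw [Real.norm_of_nonneg (mul_nonneg (by positivity) (hp0 t))]
    calc (t : ℝ) * x ^ (t - 1) * p t ≤ (t : ℝ) * x ^ (t - 1) :=
          mul_le_of_le_one_right (by positivity) (hp1 t)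
      _ ≤ _ := by
          gcongr
          exact hx.2.le
  · refine (summable_geometric_of_lt_one hθ0.le hθ1).of_nonneg_of_le
      (fun t => mul_nonneg (by positivity) (hp0 t)) fun t => ?_
    exact mul_le_of_le_one_right (by positivity) (hp1 t)

/-- Comparison with biased simple random walk: a lower bound for the logarithmic derivative of a
generating function that is sharp for the hitting times of biased simple random walk
integrates to an upper bound for the generating function. -/
theorem generatingFunction_le {H D : ℝ → ℝ} {g : ℝ} {n : ℕ} (hg : 1 < g) (hn : n ≠ 0)
    (hderiv : ∀ θ, 0 < θ → θ < 1 → HasDerivAt H (D θ / θ) θ)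
    (hpos : ∀ θ, 0 < θ → θ < 1 → 0 < H θ) (hle : ∀ θ, 0 < θ → θ < 1 → H θ ≤ θ)
    (hD : ∀ θ, 0 < θ → θ < 1 → ∀ ψ, 0 < ψ → ψ ≤ 1 → H θ = θ * ψ ^ n →
      H θ * (1 + n * ((g + ψ ^ 2) / (g - ψ ^ 2))) ≤ D θ)
    {θ ψ : ℝ} (hθ0 : 0 < θ) (hθ1 : θ < 1) (hψ0 : 0 < ψ) (hψ : H θ = θ * ψ ^ n) :
    ψ * (1 + g) ≤ θ * (ψ ^ 2 + g) := by
  have hn' : (0 : ℝ) < n := by positivity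
  set l : ℝ → ℝ := fun x => (Real.log (H x) - Real.log x) / n with hl
  have hlexp : ∀ x, 0 < x → x < 1 → H x = x * Real.exp (l x) ^ n := fun x h0 h1 => by
    rw [← Real.exp_nat_mul, hl]
    simp only
    rw [mul_div_cancel₀ _ hn'.ne', Real.exp_sub, Real.exp_log (hpos x h0 h1), Real.exp_log h0]
    field_simp
  have hlle : ∀ x, 0 < x → x < 1 → Real.exp (l x) ≤ 1 := fun x h0 h1 => by
    rw [Real.exp_le_one_iff]
    have := Real.log_le_log (hpos x h0 h1) (hle x h0 h1)
    exact div_nonpos_of_nonpos_of_nonneg (by linarith) hn'.le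
  -- For the biased walk the quadratic equation makes this the constant -log(1+g). The differential
  -- inequality says that it is nondecreasing in general.
  set Λ : ℝ → ℝ := fun x => l x - Real.log (g + Real.exp (2 * l x)) - Real.log x with hΛ
  have hΛd : ∀ x, 0 < x → x < 1 → ∃ d, 0 ≤ d ∧ HasDerivAt Λ d x := by
    intro x h0 h1
    have hH := hpos x h0 h1
    have d1 : HasDerivAt l ((D x / x / H x - x⁻¹) / n) x :=
      (((hderiv x h0 h1).log hH.ne').sub (Real.hasDerivAt_log h0.ne')).div_const _
    have hgp : 0 < g + Real.exp (2 * l x) := by positivity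
    have d2 := (d1.sub ((((d1.const_mul 2).exp).const_add g).log hgp.ne')).sub
      (Real.hasDerivAt_log h0.ne')
    refine ⟨_, ?_, d2⟩
    have hψ1 := hlle x h0 h1
    have hψp := Real.exp_pos (l x)
    have hb := hD x h0 h1 _ hψp hψ1 (hlexp x h0 h1)
    have he : Real.exp (2 * l x) = Real.exp (l x) ^ 2 := by
      rw [← Real.exp_nat_mul]
      push_cast
      rfl
    rw [he]
    set q := Real.exp (l x)
    have hgm : 0 < g - q ^ 2 := by nlinarith
    have hgq : 0 < g + q ^ 2 := by positivity
    have h2 : (g + q ^ 2) / (g - q ^ 2) / x ≤ (D x / x / H x - x⁻¹) / n := by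
      rw [le_div_iff₀ hn', ← sub_nonneg]
      have : D x / x / H x - x⁻¹ - (g + q ^ 2) / (g - q ^ 2) / x * n =
          (D x - H x * (1 + n * ((g + q ^ 2) / (g - q ^ 2)))) / (x * H x) := by
        field_simp
        ring
      rw [this]
      exact div_nonneg (by linarith) (by positivity)
    have h3 := mul_le_mul_of_nonneg_right h2 (div_pos hgm hgq).le
    have e3 : (g + q ^ 2) / (g - q ^ 2) / x * ((g - q ^ 2) / (g + q ^ 2)) = x⁻¹ := by
      field_simp
    rw [e3] at h3
    refine (sub_nonneg.2 h3).trans (le_of_eq ?_)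
    field_simp
    ring
  have hmono : MonotoneOn Λ (Set.Ioo 0 1) := by
    refine monotoneOn_of_deriv_nonneg (convex_Ioo 0 1) (fun x hx => ?_) (fun x hx => ?_)
      (fun x hx => ?_)
    · obtain ⟨d, _, hd⟩ := hΛd x hx.1 hx.2
      exact hd.continuousAt.continuousWithinAt
    · rw [interior_Ioo] at hx
      obtain ⟨d, _, hd⟩ := hΛd x hx.1 hx.2
      exact hd.differentiableAt.differentiableWithinAt
    · rw [interior_Ioo] at hx
      obtain ⟨d, h0, hd⟩ := hΛd x hx.1 hx.2
      rw [hd.deriv]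
      exact h0
  -- From (1-ψ)(g-ψ) ≥ 0. So the boundary value at θ = 1 is controlled without knowing that z is hit
  -- almost surely.
  have hbound : ∀ x, 0 < x → x < 1 → Λ x ≤ -Real.log (1 + g) - Real.log x := by
    intro x h0 h1
    have hψ1 := hlle x h0 h1
    have hψp := Real.exp_pos (l x)
    have h2 : Real.exp (l x) * (1 + g) ≤ g + Real.exp (2 * l x) := by
      rw [two_mul, Real.exp_add]
      nlinarith
    have h3 := Real.log_le_log (by positivity) h2
    rw [Real.log_mul hψp.ne' (by positivity), Real.log_exp] at h3
    simp only [hΛ]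
    linarith
  have hlim : Λ θ ≤ -Real.log (1 + g) := by
    have ht : Filter.Tendsto (fun x => -Real.log (1 + g) - Real.log x) (nhdsWithin 1 (Set.Iio 1))
        (nhds (-Real.log (1 + g))) := by
      have : ContinuousAt (fun x => -Real.log (1 + g) - Real.log x) 1 :=
        continuousAt_const.sub (Real.continuousAt_log one_ne_zero)
      have h' := this.tendsto
      rw [Real.log_one, sub_zero] at h'
      exact h'.mono_left nhdsWithin_le_nhds
    refine ge_of_tendsto ht ?_
    filter_upwards [Ioo_mem_nhdsLT hθ1] with x hx
    exact (hmono ⟨hθ0, hθ1⟩ ⟨hθ0.trans hx.1, hx.2⟩ hx.1.le).trans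
      (hbound x (hθ0.trans hx.1) hx.2)
  have hlψ : l θ = Real.log ψ := by
    simp only [hl]
    rw [hψ, Real.log_mul hθ0.ne' (by positivity), Real.log_pow]
    field_simp
    ring
  simp only [hΛ, hlψ] at hlim
  have he : Real.exp (2 * Real.log ψ) = ψ ^ 2 := by
    rw [two_mul, Real.exp_add, Real.exp_log hψ0, sq]
  rw [he] at hlim
  rw [← Real.log_le_log_iff (by positivity) (by positivity), Real.log_mul hψ0.ne' (by positivity),
    Real.log_mul hθ0.ne' (by positivity), add_comm (ψ ^ 2) g]
  linarith

end generatingFunction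

/-! ### Choice of the multipliers -/

/-- The tangent to the convex function `coth (t / 2)`, in the variable `ρ = exp t`. -/
theorem tangent_le_add_one_div_sub_one {q ρ : ℝ} (hq : 1 < q) (hρ : 1 < ρ) :
    (q + 1) / (q - 1) + 2 * q / (q - 1) ^ 2 * Real.log q - 2 * q / (q - 1) ^ 2 * Real.log ρ ≤
      (ρ + 1) / (ρ - 1) := by
  have h1 : Real.log (q / ρ) ≤ q / ρ - 1 := Real.log_le_sub_one_of_pos (by positivity)
  rw [Real.log_div (by linarith) (by linarith)] at h1
  have hq1 : 0 < q - 1 := by linarith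
  have hρ1 : 0 < ρ - 1 := by linarith
  have h2 := mul_le_mul_of_nonneg_left h1 (show 0 ≤ 2 * q / (q - 1) ^ 2 by positivity)
  have h3 : (ρ + 1) / (ρ - 1) - (q + 1) / (q - 1) - 2 * q / (q - 1) ^ 2 * (q / ρ - 1) =
      2 * (q - ρ) ^ 2 / (ρ * (ρ - 1) * (q - 1) ^ 2) := by
    field_simp
    ring
  have h4 : 0 ≤ 2 * (q - ρ) ^ 2 / (ρ * (ρ - 1) * (q - 1) ^ 2) := by positivity
  linarith

theorem two_mul_log_le {x : ℝ} (hx : 0 < x) : 2 * Real.log x ≤ x := by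
  have h1 : Real.log (x / 2) ≤ x / 2 - 1 := Real.log_le_sub_one_of_pos (by positivity)
  rw [Real.log_div hx.ne' (by norm_num)] at h1
  linarith [Real.log_two_lt_d9]

/-- If `u` is large, it beats the slope of the tangent. -/
theorem add_log_le_of_large {g q u : ℝ} (hg : 1 < g) (hq : g ≤ q)
    (hu : g ^ 2 < u * ((g - 1) ^ 2 / 2)) :
    (q + 1) / (q - 1) + 2 * q / (q - 1) ^ 2 * Real.log q +
      2 * q / (q - 1) ^ 2 * Real.log (u * ((g - 1) ^ 2 / 2) / g ^ 2) ≤ u := by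
  have hq0 : 0 < q := by linarith
  have hq1 : 0 < q - 1 := by linarith
  have hg1 : 0 < g - 1 := by linarith
  have hu0 : 0 < u := by
    by_contra h
    nlinarith [sq_nonneg (g - 1)]
  have hmono : ((g - 1) / g) ^ 2 ≤ ((q - 1) / q) ^ 2 := by
    have : (g - 1) / g ≤ (q - 1) / q := by
      rw [div_le_div_iff₀ (by linarith) (by linarith)]
      nlinarith
    exact pow_le_pow_left₀ (by positivity) this 2
  have e1 : u * ((g - 1) ^ 2 / 2) / g ^ 2 = u / 2 * ((g - 1) / g) ^ 2 := by
    field_simp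
  have h1 : 1 ≤ u * ((g - 1) ^ 2 / 2) / g ^ 2 := by
    rw [le_div_iff₀ (by positivity)]
    linarith
  -- In terms of y the right side is 2q²/(q-1)² times y. After log ≤ y - 1 and 2 log q ≤ q both
  -- sides are linear in y, so it is enough to compare them at y = 1 and to compare slopes.
  set y := u / 2 * ((q - 1) / q) ^ 2 with hy
  have hle : u * ((g - 1) ^ 2 / 2) / g ^ 2 ≤ y := by
    rw [e1]
    exact mul_le_mul_of_nonneg_left hmono (by positivity)
  have hy1 : 1 ≤ y := h1.trans hle
  have hlog : Real.log (u * ((g - 1) ^ 2 / 2) / g ^ 2) ≤ y - 1 :=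
    (Real.log_le_log (by linarith) hle).trans (Real.log_le_sub_one_of_pos (by linarith))
  have hlq : 2 * Real.log q ≤ q := two_mul_log_le (by linarith)
  have hc : 0 < 2 * q / (q - 1) ^ 2 := by positivity
  have h2 := mul_le_mul_of_nonneg_left hlog hc.le
  have h3 := mul_le_mul_of_nonneg_left hlq (show 0 ≤ q / (q - 1) ^ 2 by positivity)
  have e2 : u = y * (2 * q ^ 2 / (q - 1) ^ 2) := by
    rw [hy]
    field_simp
  have e3 : (q + 1) / (q - 1) = (q ^ 2 - 1) / (q - 1) ^ 2 := by
    field_simp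
    ring
  have e4 : (q ^ 2 - 1) / (q - 1) ^ 2 + q / (q - 1) ^ 2 * q ≤ 2 * q ^ 2 / (q - 1) ^ 2 := by
    rw [← sub_nonneg]
    have : 2 * q ^ 2 / (q - 1) ^ 2 - ((q ^ 2 - 1) / (q - 1) ^ 2 + q / (q - 1) ^ 2 * q) =
        1 / (q - 1) ^ 2 := by
      field_simp
      ring
    rw [this]
    positivity
  have e5 : 2 * q / (q - 1) ^ 2 ≤ 2 * q ^ 2 / (q - 1) ^ 2 := by
    gcongr
    nlinarith
  have e6 : 2 * q / (q - 1) ^ 2 * Real.log q = q / (q - 1) ^ 2 * (2 * Real.log q) := by ring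
  rw [e3, e6]
  have h7 : 0 ≤ (y - 1) * (2 * q ^ 2 / (q - 1) ^ 2 - 2 * q / (q - 1) ^ 2) :=
    mul_nonneg (by linarith) (by linarith)
  refine le_trans ?_ e2.ge
  linarith

/-- `mean_ge` with the tangent at q = g/ψ², chosen so that q^n h(o)² = θ² g^n: then U = q^n is
admissible when w_z a(o) ≤ g^n, and the logarithms cancel. Otherwise U exceeds q^n by a factor whose
logarithm is paid for by the visits to o. -/
theorem IsDiscountedPair.mean_ge_biased {V : Type*} {w : V → V → ℝ} {W : V → ℝ} {z : Set V} {o : V}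
    {θ : ℝ} {a h : V → ℝ} (P : IsDiscountedPair w W z o θ a h) {wz : ℝ}
    (hwz : HasSum (z.indicator W) wz) {κ : V → ℝ} {n : ℕ} (hn : n ≠ 0)
    (hκ : ∀ x y, w x y ≠ 0 → κ y - κ x ≤ 1) (hκz : ∀ x, ∀ y ∈ z, w x y ≠ 0 → κ x = n)
    (hκo : κ o = 0) (hoz : ∀ y ∈ z, w o y = 0) {g ψ : ℝ} (hg : 1 < g) (hψ0 : 0 < ψ) (hψ1 : ψ ≤ 1)
    (hH : h o = θ * ψ ^ n)
    (hgw : wz * a o ≤ g ^ n ∨ (g - 1) ^ 2 * g ^ ((n : ℤ) - 2) * W o = 2 * wz) :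
    h o * (1 + n * ((g + ψ ^ 2) / (g - ψ ^ 2))) ≤ ∑' x, W x * a x * h x := by
  have hθ := P.discount_pos
  have hψ2 : ψ ^ 2 ≤ 1 := pow_le_one₀ hψ0.le hψ1
  have hn1 : (1 : ℝ) ≤ n := by exact_mod_cast Nat.one_le_iff_ne_zero.2 hn
  set q : ℝ := g / ψ ^ 2 with hq
  have hgq : g ≤ q := by
    rw [hq, le_div_iff₀ (by positivity)]
    nlinarith
  have hq1 : 1 < q := hg.trans_le hgq
  have hm : (g + ψ ^ 2) / (g - ψ ^ 2) = (q + 1) / (q - 1) := by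
    have h1 : g - ψ ^ 2 ≠ 0 := by linarith
    have h2 : g / ψ ^ 2 - 1 ≠ 0 := by
      rw [← hq]
      linarith
    rw [hq]
    field_simp
  have hho : 0 < h o := by
    rw [hH]
    positivity
  have hqn : q ^ n * h o ^ 2 = θ ^ 2 * g ^ n := by
    rw [hH, hq, div_pow, ← pow_mul, mul_comm 2 n, pow_mul]
    field_simp
  have hlog0 : 0 ≤ Real.log q := Real.log_nonneg hq1.le
  have hq1' : 0 < q - 1 := by linarith
  have hc : 0 ≤ 2 * q / (q - 1) ^ 2 := by positivity
  have hα : 0 ≤ (q + 1) / (q - 1) + 2 * q / (q - 1) ^ 2 * Real.log q := by positivity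
  rw [hm]
  rcases le_or_gt (wz * a o) (g ^ n) with hle | hgt
  · have hU : θ ^ 2 * wz * a o ≤ q ^ n * h o ^ 2 := by
      rw [hqn, mul_assoc]
      exact mul_le_mul_of_nonneg_left hle (by positivity)
    have key := P.mean_ge (κ := κ) (η := 0) hwz hα hc
      (fun ρ hρ => tangent_le_add_one_div_sub_one hq1 hρ) (fun x _ y _ => hκ x y)
      (fun x _ => hκz x) hoz (Or.inl rfl) hho (by positivity) hU
    rw [Real.log_pow, hκo] at key
    refine le_trans (le_of_eq ?_) key
    ring
  · have heq := hgw.resolve_left (not_le.2 hgt)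
    have hgn : g ^ ((n : ℤ) - 2) * g ^ 2 = g ^ n := by
      rw [← zpow_natCast g 2, ← zpow_add₀ (by linarith), ← zpow_natCast g n]
      congr 1
      push_cast
      ring
    set u : ℝ := W o * a o with hu
    have hwa : wz * a o = u * ((g - 1) ^ 2 / 2) / g ^ 2 * g ^ n := by
      rw [← hgn, hu]
      have : wz = (g - 1) ^ 2 * g ^ ((n : ℤ) - 2) * W o / 2 := by linarith
      rw [this]
      field_simp
    have hlarge : g ^ 2 < u * ((g - 1) ^ 2 / 2) := by
      rw [hwa, lt_mul_iff_one_lt_left (by positivity), one_lt_div (by positivity)] at hgt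
      exact hgt
    have hU0 : 0 < u * ((g - 1) ^ 2 / 2) / g ^ 2 := by
      have : 0 < u * ((g - 1) ^ 2 / 2) := lt_trans (by positivity) hlarge
      positivity
    have hU : θ ^ 2 * wz * a o ≤ (u * ((g - 1) ^ 2 / 2) / g ^ 2 * q ^ n) * h o ^ 2 := by
      rw [mul_assoc (θ ^ 2), mul_assoc _ (q ^ n), hqn, hwa]
      exact le_of_eq (by ring)
    -- Levels 0 and 1 are merged. One level, worth α, is lost, but all steps from o now count in
    -- full; `add_log_le_of_large` says that the gain w_o a(o) covers the loss and the logarithm.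
    have hmax : ∀ y, w o y ≠ 0 → max (κ y) 1 = max (κ o) 1 := fun y hy => by
      have := hκ o y hy
      rw [hκo] at this ⊢
      rw [max_eq_right (by linarith), max_eq_right zero_le_one]
    have key := P.mean_ge (κ := fun x => max (κ x) 1) (η := 1) (n := n) hwz hα hc
      (fun ρ hρ => tangent_le_add_one_div_sub_one hq1 hρ) (fun x _ y _ hxy => ?_)
      (fun x _ y hy hxy => ?_) hoz (Or.inr ⟨rfl, hmax⟩) hho (by positivity) hU
    · rw [Real.log_mul hU0.ne' (by positivity), Real.log_pow, hκo, max_eq_right zero_le_one,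
        ← hu] at key
      refine le_trans (mul_le_mul_of_nonneg_left ?_ hho.le) key
      have := add_log_le_of_large hg hgq hlarge
      nlinarith
    · have := hκ x y hxy
      rw [sub_le_iff_le_add]
      exact max_le (by linarith [le_max_left (κ x) 1]) (by linarith [le_max_right (κ x) 1])
    · rw [hκz x y hy hxy]
      exact max_eq_left hn1

/-! ### Dirichlet energy and effective resistance -/

/-- The Dirichlet energy of the discounted Green function. -/
theorem IsDiscountedPair.energy_le {V : Type*} {w : V → V → ℝ} {W : V → ℝ} {z : Set V} {o : V}
    {θ : ℝ} {a h : V → ℝ} (P : IsDiscountedPair w W z o θ a h) (hθ1 : θ ≤ 1) {B : ℝ}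
    (hB : ∀ x, a x ≤ B) :
    ∃ E ≤ 2 * a o, HasSum (fun p : V × V => w p.1 p.2 * (a p.1 - a p.2) ^ 2) E := by
  classical
  have hθ := P.discount_pos
  have hsq : Summable fun x => W x * a x ^ 2 := by
    refine (P.summable.mul_right B).of_nonneg_of_le
      (fun x => mul_nonneg (P.W_nonneg x) (sq_nonneg _)) fun x => ?_
    rw [sq, ← mul_assoc]
    exact mul_le_mul_of_nonneg_left (hB x) (mul_nonneg (P.W_nonneg x) (P.a_nonneg x))
  have hrow : ∀ x, HasSum (fun y => w x y * a x ^ 2) (W x * a x ^ 2) :=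
    fun x => (P.hasSum x).mul_right _
  have s1 : Summable fun p : V × V => w p.1 p.2 * a p.1 ^ 2 :=
    (summable_prod_of_nonneg (f := fun p : V × V => w p.1 p.2 * a p.1 ^ 2)
      fun p => mul_nonneg (P.nonneg _ _) (sq_nonneg _)).2
      ⟨fun x => (hrow x).summable, hsq.congr fun x => (hrow x).tsum_eq.symm⟩
  have h1 : HasSum (fun p : V × V => w p.1 p.2 * a p.1 ^ 2) (∑' x, W x * a x ^ 2) := by
    rw [hsq.hasSum.unique (s1.hasSum.prod_fiberwise hrow)]
    exact s1.hasSum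
  have h2 : HasSum (fun p : V × V => w p.2 p.1 * a p.2 ^ 2) (∑' x, W x * a x ^ 2) :=
    (Equiv.prodComm V V).hasSum_iff.2 h1
  have hcross : ∀ p : V × V, 0 ≤ w p.1 p.2 * a p.1 * a p.2 := fun p =>
    mul_nonneg (mul_nonneg (P.nonneg _ _) (P.a_nonneg _)) (P.a_nonneg _)
  have s3 : Summable fun p : V × V => w p.1 p.2 * a p.1 * a p.2 := by
    refine (s1.add h2.summable).of_nonneg_of_le hcross fun p => ?_
    rw [P.symm p.2 p.1, ← mul_add, mul_assoc]
    refine mul_le_mul_of_nonneg_left ?_ (P.nonneg _ _)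
    nlinarith [sq_nonneg (a p.1 - a p.2), sq_nonneg (a p.1), sq_nonneg (a p.2)]
  have hrow3 : ∀ x, HasSum (fun y => w x y * a x * a y)
      (W x * a x ^ 2 / θ - if x = o then a o / θ else 0) := fun x => by
    by_cases hxo : x = o
    · subst hxo
      exact hasSum_of_eq (P.a_step_pole.mul_left (a x)) (fun y => by ring)
        (by rw [if_pos rfl]; ring)
    · by_cases hx : x ∈ z
      · simpa [P.a_of_mem x hx, hxo] using hasSum_zero
      · exact hasSum_of_eq ((P.a_step x hx hxo).mul_left (a x)) (fun y => by ring)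
          (by rw [if_neg hxo]; ring)
  have h3 : HasSum (fun p : V × V => w p.1 p.2 * a p.1 * a p.2)
      ((∑' x, W x * a x ^ 2) / θ - a o / θ) := by
    have e := s3.hasSum.prod_fiberwise hrow3
    rw [((hsq.hasSum.div_const θ).sub (hasSum_ite_eq o (a o / θ))).unique e]
    exact s3.hasSum
  have hnn : 0 ≤ (∑' x, W x * a x ^ 2) / θ - a o / θ := h3.nonneg hcross
  -- With S this sum, the energy over ordered pairs is 2S - 2(S - a(o))/θ. As S ≥ a(o) and θ ≤ 1,
  -- this is at most 2a(o).
  have hge : a o ≤ ∑' x, W x * a x ^ 2 := by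
    rw [← sub_div] at hnn
    by_contra hlt
    exact absurd (div_neg_of_neg_of_pos (by linarith) hθ) (not_lt.2 hnn)
  refine ⟨_, ?_, hasSum_of_eq ((h1.add h2).sub (h3.mul_left 2)) (fun p => ?_) rfl⟩
  · set T := ∑' x, W x * a x ^ 2
    have : T - a o ≤ T / θ - a o / θ := by
      rw [← sub_div, le_div_iff₀ hθ]
      nlinarith
    linarith
  · rw [P.symm p.2 p.1]
    ring

namespace WeightedGraph

variable {V : Type*} (G : WeightedGraph V) {o : V} {z : Set V}

theorem energy_le_of_hasSum {f : V → ℝ} {B : V × V → ℝ} {b : ℝ} (hB : HasSum B b)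
    (hle : ∀ p : V × V, (G.w p.1 p.2 : ℝ) * (f p.1 - f p.2) ^ 2 ≤ B p) :
    G.energy f ≤ ENNReal.ofReal (b / 2) := by
  have hnn : ∀ p : V × V, 0 ≤ (G.w p.1 p.2 : ℝ) * (f p.1 - f p.2) ^ 2 := fun p => by positivity
  have hs : Summable fun p : V × V => (G.w p.1 p.2 : ℝ) * (f p.1 - f p.2) ^ 2 :=
    hB.summable.of_nonneg_of_le hnn hle
  have e : ∑' x, ∑' y, (G.w x y : ℝ≥0∞) * ENNReal.ofReal ((f x - f y) ^ 2) =
      ENNReal.ofReal (∑' p : V × V, (G.w p.1 p.2 : ℝ) * (f p.1 - f p.2) ^ 2) := by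
    rw [ENNReal.ofReal_tsum_of_nonneg hnn hs, ENNReal.tsum_prod']
    refine tsum_congr fun x => tsum_congr fun y => ?_
    rw [ENNReal.ofReal_mul (by positivity), ENNReal.ofReal_coe_nnreal]
  rw [energy, e, ENNReal.ofReal_div_of_pos two_pos, ENNReal.ofReal_ofNat]
  gcongr
  exact hasSum_le hle hs.hasSum hB

theorem effConductance_le_of_hasSum {f : V → ℝ} (hfo : f o = 1) (hfz : ∀ x ∈ z, f x = 0)
    {B : V × V → ℝ} {b : ℝ} (hB : HasSum B b)
    (hle : ∀ p : V × V, (G.w p.1 p.2 : ℝ) * (f p.1 - f p.2) ^ 2 ≤ B p) :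
    G.effConductance o z ≤ ENNReal.ofReal (b / 2) :=
  (iInf₂_le f (show f ∈ {f : V → ℝ | f o = 1 ∧ ∀ x ∈ z, f x = 0} from ⟨hfo, hfz⟩)).trans
    (G.energy_le_of_hasSum hB hle)

/-- Discounting decreases the Green function, so that it is at most the effective resistance. -/
theorem ofReal_visitSeries_le_effResistance (ho : o ∉ z) (hW : G.vertexWeight o ≠ 0) {θ : ℝ}
    (hθ0 : 0 < θ) (hθ1 : θ < 1) :
    ENNReal.ofReal ((G.visitSeries o z (ENNReal.ofReal θ) o).toReal /
      (G.vertexWeight o).toReal) ≤ G.effResistance o z := by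
  have P := G.isDiscountedPair ho hW hθ0 hθ1
  have hWo : 0 < (G.vertexWeight o).toReal := ENNReal.toReal_pos hW (G.vertexWeight_ne_top o)
  have hbt : (1 - ENNReal.ofReal θ)⁻¹ ≠ ⊤ :=
    ENNReal.inv_ne_top.2 (tsub_pos_of_lt (by simpa using hθ1)).ne'
  obtain ⟨E, hE, hsum⟩ := P.energy_le hθ1.le
    (B := (1 - ENNReal.ofReal θ)⁻¹.toReal / (G.vertexWeight o).toReal) fun x =>
      div_le_div_of_nonneg_right (ENNReal.toReal_mono hbt (G.visitSeries_le _ x)) hWo.le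
  have hao := P.a_pole_pos
  have haz := P.a_of_mem
  set a : V → ℝ := fun x => (G.visitSeries o z (ENNReal.ofReal θ) x).toReal /
    (G.vertexWeight o).toReal
  change ENNReal.ofReal (a o) ≤ _
  change ∀ x ∈ z, a x = 0 at haz
  change 0 < a o at hao
  change E ≤ 2 * a o at hE
  have hC := G.effConductance_le_of_hasSum (o := o) (z := z) (f := fun x => a x / a o)
    (div_self hao.ne') (fun x hx => by rw [haz x hx, zero_div]) (hsum.div_const (a o ^ 2))
    fun p => le_of_eq (by
      change (G.w p.1 p.2 : ℝ) * (a p.1 / a o - a p.2 / a o) ^ 2 =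
        (G.w p.1 p.2 : ℝ) * (a p.1 - a p.2) ^ 2 / a o ^ 2
      field_simp)
  rw [effResistance, ← inv_inv (ENNReal.ofReal (a o)), ENNReal.inv_le_inv]
  refine hC.trans ?_
  rw [← ENNReal.ofReal_inv_of_pos hao]
  refine ENNReal.ofReal_le_ofReal ?_
  rw [div_div, div_le_iff₀ (by positivity)]
  field_simp
  linarith

/-- The conductance is less than the weight of `z`, as `o` is not adjacent to `z`. -/
theorem effConductance_lt_setWeight (ho : o ∉ z) (hz : G.setWeight z ≠ ⊤)
    (hoz : ∀ y ∈ z, G.w o y = 0) (hC : G.effConductance o z ≠ 0) :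
    G.effConductance o z < G.setWeight z := by
  classical
  -- Without such an edge the indicator of the complement of z would have energy 0.
  obtain ⟨x, hx, y, hy, hxy⟩ : ∃ x ∉ z, ∃ y ∈ z, G.w x y ≠ 0 := by
    by_contra hcon
    push Not at hcon
    refine hC (le_antisymm ?_ zero_le)
    refine (G.effConductance_le_of_hasSum (f := fun x => if x ∈ z then 0 else 1) (if_neg ho)
      (fun x hx => if_pos hx) hasSum_zero fun p => ?_).trans (by simp)
    by_cases h1 : p.1 ∈ z <;> by_cases h2 : p.2 ∈ z
    · simp [h1, h2]
    · simp [h1, h2, G.symm p.1 p.2, hcon p.2 h2 p.1 h1]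
    · simp [h1, h2, hcon p.1 h1 p.2 h2]
    · simp [h1, h2]
  have hxo : x ≠ o := fun e => hxy (e ▸ hoz y hy)
  have hxyne : y ≠ x := fun e => hx (e ▸ hy)
  have hw : ∀ u, HasSum (fun v => (G.w u v : ℝ)) (G.vertexWeight u).toReal := fun u =>
    hasSum_of_eq (hasSum_toReal_of_tsum_eq rfl (G.vertexWeight_ne_top u))
      (fun y => (ENNReal.coe_toReal _).symm) rfl
  set Wx := (G.vertexWeight x).toReal with hWx
  set w0 : ℝ := (G.w x y : ℝ) with hw0
  have hw0pos : 0 < w0 := by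
    rw [hw0]
    exact_mod_cast pos_iff_ne_zero.2 hxy
  have hwle : w0 ≤ Wx := le_hasSum (hw x) y fun _ _ => NNReal.coe_nonneg _
  have hWpos : 0 < Wx := hw0pos.trans_le hwle
  -- The indicator of the complement of z has energy at most w_z. Lowering it by ε at x alone
  -- changes this bound by ε² w_x - 2 ε w(x,y), which is minimal, and negative, for this ε. The
  -- value at o is kept, as o is not adjacent to z.
  set ε : ℝ := w0 / Wx with hε
  have hε0 : 0 < ε := by positivity
  have hε1 : ε ≤ 1 := (div_le_one hWpos).2 hwle
  have hT : HasSum (fun p : V × V => if p.1 ∈ z then (G.w p.1 p.2 : ℝ) else 0)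
      (G.setWeight z).toReal := by
    have hzs := G.hasSum_indicator_vertexWeight hz
    have hrow : ∀ u, HasSum (fun v => if u ∈ z then (G.w u v : ℝ) else 0)
        (z.indicator (fun x => (G.vertexWeight x).toReal) u) := fun u => by
      by_cases hu : u ∈ z
      · simpa [hu] using hw u
      · simpa [hu] using hasSum_zero
    have hs : Summable fun p : V × V => if p.1 ∈ z then (G.w p.1 p.2 : ℝ) else 0 :=
      (summable_prod_of_nonneg (f := fun p : V × V => if p.1 ∈ z then (G.w p.1 p.2 : ℝ) else 0)
        fun p => by simp only [Pi.zero_apply]; split_ifs <;> simp).2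
        ⟨fun u => (hrow u).summable, hzs.summable.congr fun u => (hrow u).tsum_eq.symm⟩
    rw [hzs.unique (hs.hasSum.prod_fiberwise hrow)]
    exact hs.hasSum
  have hR : HasSum (fun p : V × V => if p.1 = x then
      ε ^ 2 * (G.w x p.2 : ℝ) - (if p.2 = y then 2 * ε * w0 else 0) else 0)
      (ε ^ 2 * Wx - 2 * ε * w0) := by
    have hinj : Function.Injective fun v : V => (x, v) := fun v v' e => (Prod.ext_iff.1 e).2
    refine (hinj.hasSum_iff (fun p hp => if_neg fun e => hp ⟨p.2, by rw [← e]⟩)).1 ?_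
    refine hasSum_of_eq (((hw x).mul_left (ε ^ 2)).sub (hasSum_ite_eq y (2 * ε * w0)))
      (fun v => ?_) rfl
    simp only [Function.comp, if_true]
  have hsw : ∀ {F : V × V → ℝ} {s : ℝ}, HasSum F s → HasSum (fun p : V × V => F (p.2, p.1)) s :=
    fun {F s} hF => (Equiv.prodComm V V).hasSum_iff.2 hF
  have hlt := G.effConductance_le_of_hasSum (o := o) (z := z)
    (f := fun v => if v ∈ z then 0 else if v = x then 1 - ε else 1)
    (by simp [ho, hxo.symm]) (fun v hv => by simp [hv]) ((hT.add (hsw hT)).add (hR.add (hsw hR)))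
    fun p => ?_
  · refine hlt.trans_lt ?_
    have h1 : w0 ≤ (G.setWeight z).toReal := by
      have := le_hasSum hT (y, x) fun p _ => by split_ifs <;> simp
      simp only [hy, if_true] at this
      rwa [G.symm y x] at this
    have h2 : ε ^ 2 * Wx - 2 * ε * w0 = -(w0 ^ 2 / Wx) := by
      rw [hε]
      field_simp
      ring
    have h3 : 0 < w0 ^ 2 / Wx := by positivity
    refine lt_of_lt_of_eq ((ENNReal.ofReal_lt_ofReal_iff (hw0pos.trans_le h1)).2 ?_)
      (ENNReal.ofReal_toReal hz)
    linarith
  · obtain ⟨u, v⟩ := p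
    have hsymm : (G.w v u : ℝ) = G.w u v := by rw [G.symm v u]
    have hnn : 0 ≤ (G.w u v : ℝ) := NNReal.coe_nonneg _
    have hsq : (1 - ε) ^ 2 ≤ 1 := by nlinarith
    have hsq' := mul_le_mul_of_nonneg_left hsq hnn
    have hεnn : 0 ≤ ε ^ 2 * (G.w u v : ℝ) := by positivity
    simp only
    by_cases hu : u ∈ z
    · have hux : u ≠ x := fun e => hx (e ▸ hu)
      by_cases hv : v ∈ z
      · have hvx : v ≠ x := fun e => hx (e ▸ hv)
        simp only [hu, hv, hux, hvx, if_true, if_false, sub_self]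
        nlinarith
      · by_cases hvx : v = x
        · subst hvx
          by_cases huy : u = y
          · subst huy
            simp only [hu, hv, hux, if_true, if_false]
            rw [hw0, hsymm]
            nlinarith
          · simp only [hu, hv, hux, huy, if_true, if_false]
            rw [hsymm]
            nlinarith
        · simp only [hu, hv, hux, hvx, if_true, if_false]
          nlinarith
    · by_cases hv : v ∈ z
      · have hvx : v ≠ x := fun e => hx (e ▸ hv)
        by_cases hux : u = x
        · subst hux
          by_cases hvy : v = y
          · subst hvy
            simp only [hu, hv, hvx, if_true, if_false]
            rw [hw0, hsymm]
            nlinarith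
          · simp only [hu, hv, hvx, hvy, if_true, if_false]
            rw [hsymm]
            nlinarith
        · simp only [hu, hv, hux, hvx, if_true, if_false]
          rw [hsymm]
          nlinarith
      · have huy : u ≠ y := fun e => hu (e ▸ hy)
        have hvy : v ≠ y := fun e => hv (e ▸ hy)
        by_cases hux : u = x <;> by_cases hvx : v = x
        · subst hux hvx
          simp only [hu, huy, if_true, if_false]
          nlinarith
        · subst hux
          simp only [hu, hv, hvx, hvy, if_true, if_false]
          nlinarith
        · subst hvx
          simp only [hu, hv, hux, huy, if_true, if_false]
          rw [hsymm]
          nlinarith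
        · simp [hu, hv, hux, hvx]

end WeightedGraph

/-! ### Comparison with the biased walk -/

namespace WeightedGraph

variable {V : Type*} (G : WeightedGraph V) {o : V} {z : Set V} {n : ℕ}

/-- The distance from `o`, truncated at `n`. -/
noncomputable def truncDist (o : V) (n : ℕ) (x : V) : ℕ := (min (G.graph.edist o x) n).toNat

theorem coe_truncDist (x : V) : (G.truncDist o n x : ℕ∞) = min (G.graph.edist o x) n :=
  ENat.natCast_toNat (ne_top_of_le_ne_top (ENat.natCast_ne_top n) (min_le_right _ _))

theorem edist_le_add_one {x y : V} (hxy : G.w x y ≠ 0) :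
    G.graph.edist o y ≤ G.graph.edist o x + 1 := by
  refine (SimpleGraph.edist_triangle (G := G.graph) (v := x)).trans ?_
  gcongr
  by_cases h : x = y
  · subst h
    simp
  · exact (SimpleGraph.edist_eq_one_iff_adj.2 (show G.graph.Adj x y from ⟨h, hxy⟩)).le

theorem truncDist_self : G.truncDist o n o = 0 := by
  simp [truncDist]

theorem truncDist_le_add_one {x y : V} (hxy : G.w x y ≠ 0) :
    G.truncDist o n y ≤ G.truncDist o n x + 1 := by
  have h := G.edist_le_add_one (o := o) hxy
  have : (G.truncDist o n y : ℕ∞) ≤ ((G.truncDist o n x + 1 : ℕ) : ℕ∞) := by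
    push_cast
    rw [coe_truncDist, coe_truncDist, ← min_add_add_right]
    exact min_le_min h le_self_add
  exact_mod_cast this

theorem le_edist_of_le_distTo (hd : ((n + 1 : ℕ) : ℕ∞) ≤ G.distTo o z) {y : V} (hy : y ∈ z) :
    ((n + 1 : ℕ) : ℕ∞) ≤ G.graph.edist o y :=
  hd.trans (iInf₂_le y hy)

/-- Neighbours of z are at distance at least n, so truncation puts them all on level n. The last
step into z is the extra 1 in the bounds. -/
theorem truncDist_eq (hd : ((n + 1 : ℕ) : ℕ∞) ≤ G.distTo o z) {x y : V} (hy : y ∈ z)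
    (hxy : G.w x y ≠ 0) : G.truncDist o n x = n := by
  have h := (G.le_edist_of_le_distTo hd hy).trans (G.edist_le_add_one hxy)
  have h' : (n : ℕ∞) ≤ G.graph.edist o x := by
    push_cast at h
    exact (ENat.add_le_add_iff_right ENat.one_ne_top).1 h
  have : (G.truncDist o n x : ℕ∞) = n := by rw [coe_truncDist, min_eq_right h']
  exact_mod_cast this

theorem notMem_of_le_distTo (hd : ((n + 1 : ℕ) : ℕ∞) ≤ G.distTo o z) : o ∉ z := fun h => by
  have := G.le_edist_of_le_distTo hd h
  simp at this

theorem w_eq_zero_of_le_distTo (hn : n ≠ 0) (hd : ((n + 1 : ℕ) : ℕ∞) ≤ G.distTo o z) :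
    ∀ y ∈ z, G.w o y = 0 := fun y hy => by
  by_contra h
  have := G.truncDist_eq hd hy h
  rw [truncDist_self] at this
  exact hn this.symm

/-- The condition on `g` under which the walk on `G` is compared to biased simple random walk. -/
def Dominated (G : WeightedGraph V) (o : V) (z : Set V) (n : ℕ) (g : ℝ) : Prop :=
  (∀ θ : ℝ, 0 < θ → θ < 1 → (G.setWeight z).toReal *
    ((G.visitSeries o z (ENNReal.ofReal θ) o).toReal / (G.vertexWeight o).toReal) ≤ g ^ n) ∨
  (g - 1) ^ 2 * g ^ ((n : ℤ) - 2) * (G.vertexWeight o).toReal = 2 * (G.setWeight z).toReal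

/-- The generating function of the hitting time is bounded by that of biased simple random walk. -/
theorem hitSeries_le_biased (hn : n ≠ 0) (hW : G.vertexWeight o ≠ 0) (hz : G.setWeight z ≠ ⊤)
    (hd : ((n + 1 : ℕ) : ℕ∞) ≤ G.distTo o z) {g : ℝ} (hg : 1 < g) (hdom : G.Dominated o z n g)
    {θ φ : ℝ} (hθ0 : 0 < θ) (hθ1 : θ < 1) (hφ0 : 0 < φ) (hφ : φ * (1 + g) = θ * (φ ^ 2 + g)) :
    hitSeries G.step z (ENNReal.ofReal θ) o ≤ ENNReal.ofReal (θ * φ ^ n) := by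
  have ho := G.notMem_of_le_distTo hd
  set H : ℝ → ℝ := fun x => ∑' t : ℕ, x ^ t * G.hitProb o z t with hHdef
  have hHeq : ∀ x, 0 < x → x < 1 →
      H x = (hitSeries G.step z (ENNReal.ofReal x) o).toReal :=
    fun x h0 h1 => (G.toReal_hitSeries h0 h1).symm
  by_cases hzero : hitSeries G.step z (ENNReal.ofReal θ) o = 0
  · rw [hzero]
    exact zero_le
  have hsum : ∀ x, 0 < x → x < 1 → Summable fun t : ℕ => x ^ t * G.hitProb o z t := fun x h0 h1 =>
    (summable_geometric_of_lt_one h0.le h1).of_nonneg_of_le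
      (fun t => mul_nonneg (by positivity) (G.hitProb_nonneg t))
      fun t => mul_le_of_le_one_right (by positivity) (G.hitProb_le_one t)
  obtain ⟨t, ht⟩ : ∃ t, G.hitProb o z t ≠ 0 := by
    by_contra hcon
    push Not at hcon
    refine hzero ((ENNReal.toReal_eq_zero_iff _).1 ?_ |>.resolve_right
      (G.hitSeries_ne_top hθ1 o))
    rw [G.toReal_hitSeries hθ0 hθ1]
    simp [hcon]
  have hpos : ∀ x, 0 < x → x < 1 → 0 < H x := fun x h0 h1 =>
    (hsum x h0 h1).tsum_pos (fun t => mul_nonneg (by positivity) (G.hitProb_nonneg t)) t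
      (mul_pos (by positivity) ((G.hitProb_nonneg t).lt_of_ne' ht))
  have hle : ∀ x, 0 < x → x < 1 → H x ≤ x := fun x h0 h1 => by
    rw [hHeq x h0 h1]
    exact (G.isDiscountedPair ho hW h0 h1).h_le o ho
  have hHpos := hpos θ hθ0 hθ1
  have hHle := hle θ hθ0 hθ1
  set ψ : ℝ := (H θ / θ) ^ (1 / (n : ℝ)) with hψ
  have hψ0 : 0 < ψ := by positivity
  have hψn : H θ = θ * ψ ^ n := by
    rw [hψ, one_div, Real.rpow_inv_natCast_pow (by positivity) hn]
    field_simp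
  have hψ1 : ψ ≤ 1 := Real.rpow_le_one (by positivity) ((div_le_one hθ0).2 hHle) (by positivity)
  have key : ψ * (1 + g) ≤ θ * (ψ ^ 2 + g) := by
    refine generatingFunction_le (H := H)
      (D := fun x => ∑' t : ℕ, (t : ℝ) * (x ^ t * G.hitProb o z t)) hg hn
      (fun x h0 h1 => hasDerivAt_tsum_pow_mul G.hitProb_nonneg G.hitProb_le_one h0 h1) hpos hle
      (fun x h0 h1 η hη0 hη1 hη => ?_) hθ0 hθ1 hψ0 hψn
    have hm := (G.isDiscountedPair ho hW h0 h1).mean_ge_biased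
      (G.hasSum_indicator_vertexWeight hz) (κ := fun v => (G.truncDist o n v : ℝ)) hn
      (fun u v huv => ?_) (fun u v hv huv => ?_) ?_ (fun v hv => ?_) hg hη0 hη1 ?_
      (hdom.imp_left fun h => h x h0 h1)
    · rw [G.tsum_visits_mul_hit ho hW h0 h1, ← hHeq x h0 h1] at hm
      exact hm
    · rw [sub_le_iff_le_add']
      exact_mod_cast G.truncDist_le_add_one (by exact_mod_cast huv)
    · exact_mod_cast G.truncDist_eq hd hv (by exact_mod_cast huv)
    · exact_mod_cast G.truncDist_self
    · exact_mod_cast G.w_eq_zero_of_le_distTo hn hd v hv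
    · rw [← hHeq x h0 h1]
      exact hη
  -- The quadratic is nonnegative at ψ. If φ < ψ ≤ 1 < g, then θ(ψ+φ) < 1+g, which makes it negative
  -- there.
  have hψφ : ψ ≤ φ := by
    by_contra hlt
    have hlt := not_le.1 hlt
    have h1 : 0 ≤ (ψ - φ) * (θ * (ψ + φ) - (1 + g)) := by nlinarith
    have h2 : θ * (ψ + φ) < 1 + g := by nlinarith
    nlinarith
  rw [← ENNReal.ofReal_toReal (G.hitSeries_ne_top (z := z) hθ1 o), ← hHeq θ hθ0 hθ1, hψn]
  gcongr

theorem meanHit_ge_biased (hn : n ≠ 0) (hW : G.vertexWeight o ≠ 0) (hz : G.setWeight z ≠ ⊤)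
    (hd : ((n + 1 : ℕ) : ℕ∞) ≤ G.distTo o z) {g : ℝ} (hg : 1 < g) (hdom : G.Dominated o z n g) :
    biasedMean g * n + 1 ≤ meanHit G.step o z := by
  by_cases htop : meanHit G.step o z = ⊤
  · rw [htop]
    exact le_top
  have hg1 : 0 < g - 1 := by linarith
  have hlow : ∀ φ, 0 < φ → φ < 1 → 1 + φ * (1 + g) * (∑ i ∈ Finset.range n, φ ^ i) / (g - φ) ≤
      (meanHit G.step o z).toReal := by
    intro φ h0 h1
    have hgφ : 0 < g - φ := by linarith
    have hden : 0 < φ ^ 2 + g := by positivity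
    set θ := φ * (1 + g) / (φ ^ 2 + g) with hθ
    have hθ0 : 0 < θ := by positivity
    have hsub : 1 - θ = (1 - φ) * (g - φ) / (φ ^ 2 + g) := by
      rw [hθ]
      field_simp
      ring
    have hsub0 : 0 < 1 - θ := by
      rw [hsub]
      exact div_pos (mul_pos (by linarith) hgφ) hden
    have hH := G.hitSeries_le_biased hn hW hz hd hg hdom hθ0 (by linarith) h0
      (by rw [hθ, div_mul_cancel₀ _ hden.ne'])
    have h := (one_add_mul_meanHit_le (z := z) G.step o (ENNReal.ofReal θ)).trans
      (add_le_add_left hH _)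
    rw [← ENNReal.ofReal_toReal htop, ← ENNReal.ofReal_one, ← ENNReal.ofReal_mul hθ0.le,
      ← ENNReal.ofReal_add zero_le_one (by positivity),
      ← ENNReal.ofReal_add (by positivity) ENNReal.toReal_nonneg,
      ENNReal.ofReal_le_ofReal_iff (by positivity)] at h
    have h2 : 1 - θ * φ ^ n ≤ (1 - θ) * (meanHit G.step o z).toReal := by linarith
    -- The difference quotient of θ φ^n at θ = 1, with the factor 1 - φ cancelled so that φ → 1 can
    -- be taken by continuity.
    have h3 : 1 - θ * φ ^ n =
        (1 - θ) * (1 + φ * (1 + g) * (∑ i ∈ Finset.range n, φ ^ i) / (g - φ)) := by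
      have hgeo := geom_sum_mul_neg φ n
      have hpow : φ ^ n = 1 - (∑ i ∈ Finset.range n, φ ^ i) * (1 - φ) := by linarith
      rw [hpow, mul_add, hsub, hθ]
      field_simp
      ring
    rw [h3] at h2
    exact le_of_mul_le_mul_left h2 hsub0
  have hlim : Filter.Tendsto
      (fun φ : ℝ => 1 + φ * (1 + g) * (∑ i ∈ Finset.range n, φ ^ i) / (g - φ))
      (nhdsWithin 1 (Set.Iio 1)) (nhds (1 + (g + 1) / (g - 1) * n)) := by
    have hc : ContinuousAt
        (fun φ : ℝ => 1 + φ * (1 + g) * (∑ i ∈ Finset.range n, φ ^ i) / (g - φ)) 1 :=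
      continuousAt_const.add (ContinuousAt.div (by fun_prop) (by fun_prop) hg1.ne')
    have h' := hc.tendsto
    have e : (1 : ℝ) + 1 * (1 + g) * (∑ i ∈ Finset.range n, 1 ^ i) / (g - 1) =
        1 + (g + 1) / (g - 1) * n := by
      simp only [one_pow, Finset.sum_const, Finset.card_range, nsmul_eq_mul, mul_one]
      ring
    rw [e] at h'
    exact h'.mono_left nhdsWithin_le_nhds
  have hreal : 1 + (g + 1) / (g - 1) * n ≤ (meanHit G.step o z).toReal := by
    refine le_of_tendsto hlim ?_
    filter_upwards [Ioo_mem_nhdsLT zero_lt_one] with φ hφ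
    exact hlow φ hφ.1 hφ.2
  rw [biasedMean_eq hg, ← ENNReal.ofReal_natCast, ← ENNReal.ofReal_mul (by positivity),
    ← ENNReal.ofReal_one, ← ENNReal.ofReal_add (by positivity) zero_le_one,
    ← ENNReal.ofReal_toReal htop]
  exact ENNReal.ofReal_le_ofReal (by linarith)

end WeightedGraph

/-! ### The tail bound -/

/-- Jensen's inequality for the time biased simple random walk takes from `0` to `1`. -/
theorem mul_biasedMean_le_log {g x s : ℝ} (hg : 1 < g) (hx : 0 < x)
    (h : x * (1 + g) = Real.exp s * (x ^ 2 + g)) : s * ((g + 1) / (g - 1)) ≤ Real.log x := by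
  have hg0 : 0 < g := by linarith
  have hs : Real.log x + Real.log (1 + g) = s + Real.log (x ^ 2 + g) := by
    have := congrArg Real.log h
    rwa [Real.log_mul hx.ne' (by positivity), Real.log_mul (Real.exp_pos s).ne' (by positivity),
      Real.log_exp] at this
  have h1 : Real.log (x ^ 2 * (1 + g) / (x ^ 2 + g)) ≤ x ^ 2 * (1 + g) / (x ^ 2 + g) - 1 :=
    Real.log_le_sub_one_of_pos (by positivity)
  have h2 : Real.log ((1 + g) / (x ^ 2 + g)) ≤ (1 + g) / (x ^ 2 + g) - 1 :=
    Real.log_le_sub_one_of_pos (by positivity)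
  rw [Real.log_div (by positivity) (by positivity), Real.log_mul (by positivity) (by positivity),
    Real.log_pow] at h1
  rw [Real.log_div (by positivity) (by positivity)] at h2
  have e : x ^ 2 * (1 + g) / (x ^ 2 + g) - 1 + g * ((1 + g) / (x ^ 2 + g) - 1) = 0 := by
    field_simp
    ring
  have h3 := mul_le_mul_of_nonneg_left h2 hg0.le
  push_cast at h1
  rw [← mul_div_assoc, div_le_iff₀ (by linarith)]
  have : s = Real.log x + Real.log (1 + g) - Real.log (x ^ 2 + g) := by linarith
  rw [this]
  nlinarith

namespace WeightedGraph

variable {V : Type*} (G : WeightedGraph V) {o : V} {z : Set V} {n : ℕ}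

theorem probHitLE_le_biased (hn : n ≠ 0) (hW : G.vertexWeight o ≠ 0) (hz : G.setWeight z ≠ ⊤)
    (hd : ((n + 1 : ℕ) : ℕ∞) ≤ G.distTo o z) {g : ℝ} (hg : 1 < g) (hdom : G.Dominated o z n g)
    {a : ℝ} (ha : ENNReal.ofReal a ≤ biasedMean g) :
    probHitLE G.step o z (a * n + 1) ≤ EReal.exp (-(biasedRate g a * (n : EReal))) := by
  have hn' : (0 : ℝ) < n := by positivity
  have ham : a ≤ (g + 1) / (g - 1) := by
    have hg1 : 0 < g - 1 := by linarith
    rwa [biasedMean_eq hg, ENNReal.ofReal_le_ofReal_iff (by positivity)] at ha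
  by_cases hp0 : probHitLE G.step o z (a * n + 1) = 0
  · rw [hp0]
    exact zero_le
  have hp1 := probHitLE_le_one (z := z) G.step o (a * n + 1)
  have hpt : probHitLE G.step o z (a * n + 1) ≠ ⊤ := ne_top_of_le_ne_top ENNReal.one_ne_top hp1
  have hC := fun (s : ℝ) (hs : s < 0) => probHitLE_mul_exp_le (z := z) G.step o hs (a * n + 1)
  set p := (probHitLE G.step o z (a * n + 1)).toReal with hp
  have hpe : probHitLE G.step o z (a * n + 1) = ENNReal.ofReal p := (ENNReal.ofReal_toReal hpt).symm
  have hppos : 0 < p := ENNReal.toReal_pos hp0 hpt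
  have hple : p ≤ 1 := ENNReal.toReal_le_of_le_ofReal zero_le_one (by simpa using hp1)
  have hL : Real.log p ≤ 0 := Real.log_nonpos hppos.le hple
  rw [hpe] at hC ⊢
  have hrate : biasedRate g a ≤ ((-Real.log p / n : ℝ) : EReal) := by
    refine iSup_le fun s => ?_
    rw [mgfHit_biased hg]
    by_cases hX : hitSeries (biasedStep g) {1} (ENNReal.ofReal (Real.exp s)) 0 = ⊤
    · rw [hX]
      simp
    obtain ⟨hx, hq⟩ := toReal_hitSeries_biased hg (Real.exp_pos s) hX
    rw [← ENNReal.ofReal_toReal hX, ENNReal.log_ofReal_of_pos hx, ← EReal.coe_sub,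
      EReal.coe_le_coe_iff]
    generalize (hitSeries (biasedStep g) {1} (ENNReal.ofReal (Real.exp s)) 0).toReal = x at hx hq
    -- For s < 0 Chernoff's bound and the comparison apply. For s ≥ 0 the comparison is not
    -- available, but Jensen and a ≤ m_g make the term nonpositive.
    rcases lt_or_ge s 0 with hs | hs
    · have h := (hC s hs).trans (G.hitSeries_le_biased hn hW hz hd hg hdom (Real.exp_pos s)
        (Real.exp_lt_one_iff.2 hs) hx hq)
      rw [← ENNReal.ofReal_mul (Real.exp_pos _).le,
        ENNReal.ofReal_le_ofReal_iff (by positivity)] at h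
      have h2 := Real.log_le_log (by positivity) h
      rw [Real.log_mul (Real.exp_pos _).ne' hppos.ne', Real.log_exp,
        Real.log_mul (Real.exp_pos _).ne' (by positivity), Real.log_exp, Real.log_pow] at h2
      rw [le_div_iff₀ hn']
      linarith
    · have h1 := mul_biasedMean_le_log hg hx hq
      have h2 := mul_le_mul_of_nonneg_left ham hs
      have h3 : 0 ≤ -Real.log p / n := div_nonneg (by linarith) hn'.le
      linarith
  have hmul : biasedRate g a * (n : EReal) ≤ ((-Real.log p : ℝ) : EReal) := by
    have hnn : (0 : EReal) ≤ (n : EReal) := by exact_mod_cast Nat.zero_le n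
    refine (mul_le_mul_of_nonneg_right hrate hnn).trans (le_of_eq ?_)
    have : (n : EReal) = ((n : ℝ) : EReal) := rfl
    rw [this, ← EReal.coe_mul, div_mul_cancel₀ _ hn'.ne']
  calc ENNReal.ofReal p = EReal.exp ((Real.log p : ℝ) : EReal) := by
        rw [EReal.exp_coe, Real.exp_log hppos]
    _ ≤ _ := EReal.exp_monotone (by
        rw [EReal.le_neg, ← EReal.coe_neg]
        exact hmul)

theorem hitBounds_of_dominated (hW : G.vertexWeight o ≠ 0) (hz : G.setWeight z ≠ ⊤)
    (hd : ((n + 1 : ℕ) : ℕ∞) ≤ G.distTo o z) {g : ℝ} (hg : 1 < g) (hdom : G.Dominated o z n g) :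
    HitBounds G o z n g := by
  rcases eq_or_ne n 0 with rfl | hn
  · refine ⟨?_, fun a _ => ?_⟩
    -- For n = 0 only T ≥ 1 is claimed; θ = 0 gives it because o is not in z.
    · have h := one_add_mul_meanHit_le (z := z) G.step o 0
      have h0 : hitSeries G.step z 0 o = 0 := by
        rw [hitSeries_of_notMem _ _ _ (G.notMem_of_le_distTo hd), zero_mul]
      rw [h0, zero_mul, add_zero, zero_add] at h
      simpa using h
    · simpa using probHitLE_le_one (z := z) G.step o 1
  · exact ⟨G.meanHit_ge_biased hn hW hz hd hg hdom,
      fun a ha => G.probHitLE_le_biased hn hW hz hd hg hdom ha⟩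

end WeightedGraph

/-! ### The equation for the growth rate, and the conclusion -/

/-- The equation for `g` has exactly one solution. -/
theorem existsUnique_growth {n : ℕ} (hn : n ≠ 0) {c : ℝ} (hc : 0 < c) :
    ∃! g : ℝ, 1 < g ∧ (g - 1) ^ 2 * g ^ ((n : ℤ) - 2) = c := by
  have hmono : ∀ x y : ℝ, 1 < x → x < y →
      (x - 1) ^ 2 * x ^ ((n : ℤ) - 2) < (y - 1) ^ 2 * y ^ ((n : ℤ) - 2) := by
    intro x y hx hxy
    -- The exponent n - 2 may be -1; this factorization into positive increasing factors treats all
    -- n ≥ 1 at once.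
    have e : ∀ t : ℝ, 1 < t → (t - 1) ^ 2 * t ^ ((n : ℤ) - 2) =
        (t - 1) * ((t - 1) / t) * t ^ (n - 1) := fun t ht => by
      have : t ^ ((n : ℤ) - 2) = t ^ (n - 1) / t := by
        rw [div_eq_mul_inv, ← zpow_natCast t (n - 1), ← zpow_sub_one₀ (show t ≠ 0 by linarith)]
        congr 1
        omega
      rw [this]
      ring
    rw [e x hx, e y (hx.trans hxy)]
    have h1 : (x - 1) / x ≤ (y - 1) / y := by
      rw [div_le_div_iff₀ (by linarith) (by linarith)]
      nlinarith
    have h2 : x ^ (n - 1) ≤ y ^ (n - 1) := pow_le_pow_left₀ (by linarith) hxy.le _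
    have h3 : 0 < (x - 1) / x := div_pos (by linarith) (by linarith)
    have h4 : 0 < x ^ (n - 1) := by positivity
    calc (x - 1) * ((x - 1) / x) * x ^ (n - 1) < (y - 1) * ((x - 1) / x) * x ^ (n - 1) := by
          gcongr
      _ ≤ (y - 1) * ((y - 1) / y) * y ^ (n - 1) := by
          have : 0 < y - 1 := by linarith
          have : 0 < y := by linarith
          gcongr
  have hbig : c ≤ (c + 2 - 1) ^ 2 * (c + 2) ^ ((n : ℤ) - 2) := by
    have h1 : (c + 2) ^ (-1 : ℤ) ≤ (c + 2) ^ ((n : ℤ) - 2) :=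
      zpow_le_zpow_right₀ (by linarith) (by omega)
    have h2 : c ≤ (c + 2 - 1) ^ 2 * (c + 2) ^ (-1 : ℤ) := by
      rw [zpow_neg_one, ← div_eq_mul_inv, le_div_iff₀ (by linarith)]
      nlinarith
    exact h2.trans (mul_le_mul_of_nonneg_left h1 (sq_nonneg _))
  have hcont : ContinuousOn (fun g : ℝ => (g - 1) ^ 2 * g ^ ((n : ℤ) - 2)) (Set.Icc 1 (c + 2)) := by
    intro g hg
    refine ContinuousAt.continuousWithinAt (ContinuousAt.mul (by fun_prop) ?_)
    exact continuousAt_zpow₀ g _ (Or.inl (by linarith [hg.1]))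
  obtain ⟨g, hg, hgc⟩ := intermediate_value_Icc (by linarith : (1 : ℝ) ≤ c + 2) hcont
    (show c ∈ Set.Icc _ _ from ⟨by simpa using hc.le, hbig⟩)
  have hg1 : 1 < g := lt_of_le_of_ne hg.1 fun e => by
    rw [← e] at hgc
    simp at hgc
    linarith
  refine ⟨g, ⟨hg1, hgc⟩, fun y ⟨hy1, hyc⟩ => ?_⟩
  simp only at hgc
  rcases lt_trichotomy y g with h | h | h
  · linarith [hmono y g hy1 h]
  · exact h
  · linarith [hmono g y hg1 h]

theorem theorem1 {V : Type*} (G : WeightedGraph V) (o : V) (z : Set V) (n : ℕ)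
    (ho : G.vertexWeight o ≠ 0) (hz : G.setWeight z ≠ ∞)
    (hd : ((n + 1 : ℕ) : ℕ∞) ≤ G.distTo o z) :
    -- part (a): the solution exists and is unique, and the bounds hold for it
    ((n ≠ 0 → G.setWeight z ≠ 0 →
        ∃! g : ℝ, 1 < g ∧
          (g - 1) ^ 2 * g ^ ((n : ℤ) - 2) = 2 * (G.setWeight z / G.vertexWeight o).toReal) ∧
      ∀ g : ℝ, 1 < g →
        (g - 1) ^ 2 * g ^ ((n : ℤ) - 2) = 2 * (G.setWeight z / G.vertexWeight o).toReal →
        HitBounds G o z n g) ∧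
    -- part (b)
    (n ≠ 0 → G.effResistance o z ≠ ∞ →
      ∀ g : ℝ, g = (G.setWeight z * G.effResistance o z).toReal ^ (1 / (n : ℝ)) →
        1 < g ∧ HitBounds G o z n g) ∧
    -- the classical formulas for the mean and the rate function of biased simple random walk
    (∀ g : ℝ, 1 < g →
      biasedMean g = ENNReal.ofReal ((g + 1) / (g - 1)) ∧
      ∀ a : ℝ, 1 < a →
        EReal.exp (-biasedRate g a) =
          ENNReal.ofReal (g / (a + 1) * (g / (a ^ 2 - 1)) ^ ((a - 1) / 2) *
            (2 * a / (g + 1)) ^ a)) := by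
  have hWo : 0 < (G.vertexWeight o).toReal := ENNReal.toReal_pos ho (G.vertexWeight_ne_top o)
  refine ⟨⟨fun hn hz0 => existsUnique_growth hn ?_, fun g hg hgeq => ?_⟩, fun hn hr g hgdef => ?_,
    fun g hg => ⟨biasedMean_eq hg, fun a ha => exp_neg_biasedRate hg ha⟩⟩
  · have : 0 < (G.setWeight z).toReal := ENNReal.toReal_pos hz0 hz
    rw [ENNReal.toReal_div]
    positivity
  · refine G.hitBounds_of_dominated ho hz hd hg (Or.inr ?_)
    rw [hgeq, ENNReal.toReal_div]
    field_simp
  · have hoz := G.notMem_of_le_distTo hd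
    have hC0 : G.effConductance o z ≠ 0 := fun h => hr (by rw [WeightedGraph.effResistance, h,
      ENNReal.inv_zero])
    have hlt := G.effConductance_lt_setWeight hoz hz (G.w_eq_zero_of_le_distTo hn hd) hC0
    have hfin : G.setWeight z * G.effResistance o z ≠ ⊤ := ENNReal.mul_ne_top hz hr
    have hone : 1 < (G.setWeight z * G.effResistance o z).toReal := by
      rw [← ENNReal.toReal_one, ENNReal.toReal_lt_toReal ENNReal.one_ne_top hfin,
        WeightedGraph.effResistance, ← div_eq_mul_inv,
        ENNReal.lt_div_iff_mul_lt (Or.inl hC0) (Or.inl hlt.ne_top), one_mul]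
      exact hlt
    have hg : 1 < g := by
      rw [hgdef]
      exact Real.one_lt_rpow hone (by positivity)
    -- Here g^n is w_z times the effective resistance, which bounds every discounted Green function
    -- at o.
    refine ⟨hg, G.hitBounds_of_dominated ho hz hd hg (Or.inl fun θ h0 h1 => ?_)⟩
    rw [hgdef, one_div, Real.rpow_inv_natCast_pow ENNReal.toReal_nonneg hn, ENNReal.toReal_mul]
    refine mul_le_mul_of_nonneg_left ?_ ENNReal.toReal_nonneg
    exact (ENNReal.ofReal_le_iff_le_toReal hr).1
      (G.ofReal_visitSeries_le_effResistance hoz ho h0 h1)
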